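/- **Setting.** Let $M$ be a real-analytic manifold of dimension $m+n$ with a real-analytic locally integrable structure of rank $n$: a real-analytic subbundle $\mathcal V\subset\mathbb CTM$ of rank $n$ with $[\mathcal V,\mathcal V]\subset\mathcal V$ whose annihilator $T'\subset\mathbb CT^*M$ is locally spanned by the differentials of $m$ smooth complex functions. Let $T'^{p,q}\subset\Lambda^{p+q}\mathbb CT^*M$ be the part of degree $p+q$ of the ideal generated by $\Lambda^pT'$, let $\Lambda^{p,q}=T'^{p,q}/T'^{p+1,q-1}$, and let ${\rm d}'$ be the operator from sections of $\Lambda^{p,q}$ to sections of $\Lambda^{p,q+1}$ induced by the exterior derivative. Thus a section of $\Lambda^{0,q}$ is represented by a $q$-form $f$, it is a cocycle if $df$ is a section of $T'^{1,q}$, and $\Lambda^{m,r}=T'^{m,r}$ is a bundle of $(m+r)$-forms on which ${\rm d}'=d$. Let $x_0\in M$, fix a real-analytic chart at $x_0$, and identify its domain with an open subset of $\mathbb R^{m+n}$. For $s>1$, $C>0$, $K$ compact and $g$ smooth put $$\|g\|_{K,C}=\sup_{\alpha}C^{-|\alpha|}(\alpha!)^{-s}\sup_{x\in K}|\partial^\alpha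 g(x)| ,$$ and for a form let $\|\cdot\|_{K,C}$ be the maximum of the norms of its coefficients with respect to the coordinates. For $\Omega$ open, $G^s(\Omega,C)$ is the space of smooth $g$ on $\Omega$ with $\|g\|_{K,C}<\infty$ for all compact $K\subset\Omega$; $G^s(\Omega)$ is the space of smooth $g$ on $\Omega$ such that for every compact $K\subset\Omega$ there is a $C>0$ with $\|g\|_{K,C}<\infty$; $G^s_0(K,C)$ is the space of smooth $g$ supported in $K$ with $\|g\|_{K,C}<\infty$; and $G^s_0(\Omega)=\bigcup_{K\subset\Omega,\,C>0}G^s_0(K,C)$. The notations $G^s(\Omega,C;\Lambda^{0,q})$ (given by representatives), $G^s_0(K,C;\Lambda^{m,r})$, etc., refer to forms with such coefficients. The space $\mathcal D'_s(\Omega,\Lambda^{0,r})$ consists of the linear functionals $u$ on $G^s_0(\Omega;\Lambda^{m,n-r})$ such that for all compact $K\subset\Omega$ and $C>0$ there is a $C'>0$ with $|\langle u,v\rangle|\le C'\|v\|_{K,C}$ for all $v\in G^s_0(K,C;\Lambda^{m,n-r})$. Let $1\le q\le n$. The complex ${\rm d}'$ is *locally solvable near $x_0$ in degree $q$ in the sense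 of ultradistributions of order $s$* if for every sufficiently small open neighbourhood $\Omega$ of $x_0$ and every cocycle $f\in G^s(\Omega,\Lambda^{0,q})$ there are an open neighbourhood $V\subset\Omega$ of $x_0$ and $u\in\mathcal D'_s(V,\Lambda^{0,q-1})$ with ${\rm d}'u=f$ in $V$, i.e. $(-1)^q\langle u,{\rm d}'v\rangle=\int_V f\wedge v$ for all $v\in G^s_0(V;\Lambda^{m,n-q})$. **Proposition.** Let $s>1$ and $1\le q\le n$, and suppose that ${\rm d}'$ is locally solvable near $x_0$ in degree $q$ in the sense of ultradistributions of order $s$. Then for every sufficiently small open neighbourhood $\Omega$ of $x_0$, every $C_1>0$ and all $0<\epsilon<C_2$ there exist a compact set $K\subset\Omega$, an open neighbourhood $\Omega'\Subset\Omega$ of $x_0$ and a constant $C'>0$ such that, for every cocycle $f\in G^s(\Omega,C_1;\Lambda^{0,q})$ and every $v\in G^s_0(\overline{\Omega'},C_2-\epsilon;\Lambda^{m,n-q})$, one has $\|{\rm d}'v\|_{\overline{\Omega'},C_2}<\infty$ and $$\Big|\int_\Omega f\wedge v\Big|\le C'\,\|f\|_{K,C_1}\,\|{\rm d}'v\|_{\overline{\Omega'},C_2}.$$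 -/

import Mathlib

open scoped ContDiff Manifold TensorProduct

noncomputable section

/-- Euclidean space `ℝᴺ`. -/
abbrev Eu (N : ℕ) : Type := EuclideanSpace ℝ (Fin N)

/-- The standard basis vectors of `ℝᴺ`. -/
def stdVec {N : ℕ} (i : Fin N) : Eu N := EuclideanSpace.single i (1 : ℝ)

/-- Complex-valued differential forms of degree `k` in (an open subset of) `ℝᴺ`. Forms on an open
set `Ω` are represented by total functions of which only the values on `Ω` are used. -/
abbrev DForm (N k : ℕ) : Type := Eu N → (Eu N) [⋀^Fin k]→L[ℝ] ℂ

/-! ### Locally integrable structures -/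

section Structure

variable {N : ℕ} {M : Type*} [TopologicalSpace M] [ChartedSpace (Eu N) M]

/-- The complex tangent space `ℂT_xM = ℂ ⊗ T_xM`. -/
abbrev CTangent (N : ℕ) {M : Type*} [TopologicalSpace M] [ChartedSpace (Eu N) M] (x : M) : Type :=
  ℂ ⊗[ℝ] TangentSpace 𝓘(ℝ, Eu N) x

/-- The complex cotangent space `ℂT*_xM`: real-linear maps `T_xM → ℂ`. -/
abbrev CCotangent (N : ℕ) {M : Type*} [TopologicalSpace M] [ChartedSpace (Eu N) M] (x : M) : Type :=
  TangentSpace 𝓘(ℝ, Eu N) x →L[ℝ] ℂ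

/-- The complex tangent vector `a + i b`. -/
def mkCTangent {x : M} (a b : TangentSpace 𝓘(ℝ, Eu N) x) : CTangent N x :=
  (1 : ℂ) ⊗ₜ[ℝ] a + Complex.I ⊗ₜ[ℝ] b

/-- The pairing of a complex covector with a complex tangent vector. -/
def cPair {x : M} (ζ : CCotangent N x) : CTangent N x →ₗ[ℂ] ℂ :=
  LinearMap.liftBaseChange ℂ (ζ : TangentSpace 𝓘(ℝ, Eu N) x →ₗ[ℝ] ℂ)

/-- The annihilator in `ℂT*_xM` of a subspace of `ℂT_xM`. -/
def annihilator {x : M} (V : Submodule ℂ (CTangent N x)) : Submodule ℂ (CCotangent N x) where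
  carrier := {ζ | ∀ v ∈ V, cPair ζ v = 0}
  zero_mem' := by
    intro v _
    have h : cPair (0 : CCotangent N x) = 0 := by
      simp [cPair]
    simp [h]
  add_mem' := by
    intro a b ha hb v hv
    have h : cPair (a + b) = cPair a + cPair b := by
      simp only [cPair, ← map_add]; rfl
    simp [h, ha v hv, hb v hv]
  smul_mem' := by
    intro c a ha v hv
    have h : cPair (c • a) = c • cPair a := by
      simp only [cPair, ← map_smul]; rfl
    simp [h, ha v hv]

/-- A vector field `X` on `M` is of class `C^r` on the set `U`. -/
def SmoothField [IsManifold 𝓘(ℝ, Eu N) 1 M] (r : ℕ∞ω)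
    (X : ∀ x : M, TangentSpace 𝓘(ℝ, Eu N) x) (U : Set M) : Prop :=
  ContMDiffOn 𝓘(ℝ, Eu N) (𝓘(ℝ, Eu N)).tangent r
    (fun x => (⟨x, X x⟩ : TangentBundle 𝓘(ℝ, Eu N) M)) U

end Structure

/-- A real-analytic locally integrable structure of rank `n` on a real-analytic manifold `M` of
dimension `m + n`: a real-analytic rank-`n` subbundle `V` of `ℂTM` which satisfies the Frobenius
condition `[V, V] ⊆ V` and whose annihilator `T' ⊆ ℂT*M` is locally spanned by the differentials
of `m` smooth complex-valued functions. -/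
structure LocallyIntegrableStructure (m n : ℕ) (M : Type*) [TopologicalSpace M]
    [ChartedSpace (Eu (m + n)) M] [IsManifold 𝓘(ℝ, Eu (m + n)) ω M] where
  /-- the subbundle -/
  V : ∀ x : M, Submodule ℂ (CTangent (m + n) x)
  /-- `V` is locally spanned by `n` real-analytic, linearly independent complex fields `X + iY` -/
  analytic_subbundle : ∀ x₀ : M, ∃ U : Set M, IsOpen U ∧ x₀ ∈ U ∧
    ∃ X Y : Fin n → ∀ x : M, TangentSpace 𝓘(ℝ, Eu (m + n)) x,
      (∀ j, SmoothField ω (X j) U ∧ SmoothField ω (Y j) U) ∧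
      ∀ x ∈ U, LinearIndependent ℂ (fun j => mkCTangent (X j x) (Y j x)) ∧
        V x = Submodule.span ℂ (Set.range fun j => mkCTangent (X j x) (Y j x))
  /-- `V` is closed under the bracket
  `[X₁ + iY₁, X₂ + iY₂] = [X₁, X₂] - [Y₁, Y₂] + i([X₁, Y₂] + [Y₁, X₂])` -/
  frobenius : ∀ U : Set M, IsOpen U →
    ∀ X₁ Y₁ X₂ Y₂ : ∀ x : M, TangentSpace 𝓘(ℝ, Eu (m + n)) x,
      SmoothField ∞ X₁ U → SmoothField ∞ Y₁ U → SmoothField ∞ X₂ U → SmoothField ∞ Y₂ U →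
      (∀ x ∈ U, mkCTangent (X₁ x) (Y₁ x) ∈ V x) → (∀ x ∈ U, mkCTangent (X₂ x) (Y₂ x) ∈ V x) →
      ∀ x ∈ U, mkCTangent
        (VectorField.mlieBracket 𝓘(ℝ, Eu (m + n)) X₁ X₂ x
          - VectorField.mlieBracket 𝓘(ℝ, Eu (m + n)) Y₁ Y₂ x)
        (VectorField.mlieBracket 𝓘(ℝ, Eu (m + n)) X₁ Y₂ x
          + VectorField.mlieBracket 𝓘(ℝ, Eu (m + n)) Y₁ X₂ x) ∈ V x
  /-- `T'` is locally spanned by exact differentials -/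
  locally_exact : ∀ x₀ : M, ∃ U : Set M, IsOpen U ∧ x₀ ∈ U ∧
    ∃ Z : Fin m → M → ℂ, (∀ i, ContMDiffOn 𝓘(ℝ, Eu (m + n)) 𝓘(ℝ, ℂ) ∞ (Z i) U) ∧
      ∀ x ∈ U, annihilator (V x) = Submodule.span ℂ
        (Set.range fun i => (mfderiv 𝓘(ℝ, Eu (m + n)) 𝓘(ℝ, ℂ) (Z i) x : CCotangent (m + n) x))

section Chart

variable {m n : ℕ} {M : Type*} [TopologicalSpace M] [ChartedSpace (Eu (m + n)) M]
  [IsManifold 𝓘(ℝ, Eu (m + n)) ω M]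

/-- The bundle `T' = V^⊥`. -/
def LocallyIntegrableStructure.T' (S : LocallyIntegrableStructure m n M) (x : M) :
    Submodule ℂ (CCotangent (m + n) x) :=
  annihilator (S.V x)

/-- The pull-back of complex covectors by the differential of the chart `φ` at `x`. -/
def chartPullback (φ : OpenPartialHomeomorph M (Eu (m + n))) (x : M) :
    (Eu (m + n) →L[ℝ] ℂ) →ₗ[ℂ] CCotangent (m + n) x where
  toFun := fun ζ => ζ.comp
    (mfderiv 𝓘(ℝ, Eu (m + n)) 𝓘(ℝ, Eu (m + n)) φ x :
      TangentSpace 𝓘(ℝ, Eu (m + n)) x →L[ℝ] Eu (m + n))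
  map_add' := fun _ _ => rfl
  map_smul' := fun _ _ => rfl

/-- The bundle `T'` read in the chart `φ`: at `y ∈ φ.target` it consists of the complex covectors
`ζ` of `ℝ^(m+n)` whose pull-back by `dφ` belongs to `T'` at `φ⁻¹(y)`. -/
def LocallyIntegrableStructure.inChart (S : LocallyIntegrableStructure m n M)
    (φ : OpenPartialHomeomorph M (Eu (m + n))) (y : Eu (m + n)) :
    Submodule ℂ (Eu (m + n) →L[ℝ] ℂ) :=
  (S.T' (φ.symm y)).comap (chartPullback φ (φ.symm y))

end Chart

/-! ### Exterior algebra -/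

/-- The wedge product `ζ ∧ b` of a complex covector and a complex `k`-covector:
`(ζ ∧ b)(v₀, …, v_k) = ∑ᵢ (-1)ⁱ ζ(vᵢ) b(v₀, …, v̂ᵢ, …, v_k)`. -/
def covectorWedge {N k : ℕ} (ζ : Eu N →L[ℝ] ℂ) (b : (Eu N) [⋀^Fin k]→L[ℝ] ℂ) :
    (Eu N) [⋀^Fin (k + 1)]→L[ℝ] ℂ :=
  ContinuousAlternatingMap.alternatizeUncurryFin (ζ.smulRight b)

/-- `idealPart W p k` is the homogeneous part of degree `k` of the ideal generated by `Λ^p W` in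
the complex exterior algebra, i.e. the complex span of all `ζ₁ ∧ ⋯ ∧ ζ_p ∧ b` with `ζᵢ ∈ W` and
`b` of degree `k - p`. For `W = T'_x` the space `T'^{p,q}` is `idealPart W p (p + q)`. -/
def idealPart {N : ℕ} (W : Submodule ℂ (Eu N →L[ℝ] ℂ)) :
    ℕ → (k : ℕ) → Submodule ℂ ((Eu N) [⋀^Fin k]→L[ℝ] ℂ)
  | 0, _ => ⊤
  | _ + 1, 0 => ⊥
  | p + 1, k + 1 => Submodule.span ℂ {a | ∃ ζ ∈ W, ∃ b ∈ idealPart W p k, a = covectorWedge ζ b}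

/-- For `a` of degree `q`, `b` of degree `k` and `q + k = N`, the coefficient of `a ∧ b` with
respect to `dx₁ ∧ ⋯ ∧ dx_N`, i.e. `(a ∧ b)(e₁, …, e_N)`. -/
def topWedge {N q k : ℕ} (h : q + k = N) (a : (Eu N) [⋀^Fin q]→L[ℝ] ℂ)
    (b : (Eu N) [⋀^Fin k]→L[ℝ] ℂ) : ℂ :=
  LinearMap.mul' ℝ ℂ
    ((a.toAlternatingMap.domCoprod b.toAlternatingMap)
      fun i => stdVec (Fin.cast h (finSumFinEquiv i)))

/-! ### Gevrey classes -/

/-- The partial derivative `∂^α g (x)`, `α` a multi-index: the derivative of order `|α|` applied to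
`α 0` copies of the first basis vector, `α 1` copies of the second one, and so on. -/
def multiDeriv {N : ℕ} (α : Fin N → ℕ) (g : Eu N → ℂ) (x : Eu N) : ℂ :=
  iteratedFDeriv ℝ (∑ i, α i) g x (fun j => stdVec (finSigmaFinEquiv.symm j).1)

/-- `‖g‖_{K,C} = sup_α C^{-|α|} (α!)^{-s} sup_{x ∈ K} |∂^α g(x)|`, with values in `[0, ∞]`. -/
def gevreyNorm {N : ℕ} (s C : ℝ) (K : Set (Eu N)) (g : Eu N → ℂ) : ENNReal :=
  ⨆ α : Fin N → ℕ, ⨆ x ∈ K, ENNReal.ofReal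
    (C⁻¹ ^ (∑ i, α i) * ((∏ i, (α i).factorial : ℕ) : ℝ) ^ (-s) * ‖multiDeriv α g x‖)

/-- The norm `‖f‖_{K,C}` of a form: the largest norm of its coefficients
`f_I = f(e_{I 0}, …, e_{I (k-1)})`. (Repeating an index or permuting the indices gives `0` or
`± f_J` with `J` increasing.) -/
def formNorm {N k : ℕ} (s C : ℝ) (K : Set (Eu N)) (f : DForm N k) : ENNReal :=
  ⨆ I : Fin k → Fin N, gevreyNorm s C K (fun x => f x (fun j => stdVec (I j)))

/-- Forms of degree `k` with coefficients in `G^s(Ω, C)`. -/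
def IsGevreyForm {N k : ℕ} (s C : ℝ) (Ω : Set (Eu N)) (f : DForm N k) : Prop :=
  ContDiffOn ℝ ∞ f Ω ∧ ∀ K ⊆ Ω, IsCompact K → formNorm s C K f < ⊤

/-- Forms of degree `k` with coefficients in `G^s(Ω)`. -/
def IsGevreyFormSome {N k : ℕ} (s : ℝ) (Ω : Set (Eu N)) (f : DForm N k) : Prop :=
  ContDiffOn ℝ ∞ f Ω ∧ ∀ K ⊆ Ω, IsCompact K → ∃ C : ℝ, 0 < C ∧ formNorm s C K f < ⊤

/-! ### The complex `d'`

A section of `Λ^{0,q} = ΛᑫℂT*M / T'^{1,q-1}` is given by a form of degree `q`, which represents its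
class, and `d'` is induced by the exterior derivative. Since `T'` has rank `m`, the bundle
`Λ^{m,r} = T'^{m,r} / T'^{m+1,r-1}` is `T'^{m,r}` itself, a bundle of forms of degree `m + r`. -/

/-- The class in `Λ^{0,q}` of the form `f` of degree `q` is a cocycle on `Ω`: `d'[f] = 0` in
`Λ^{0,q+1}`, i.e. `df` is a section of `T'^{1,q}`. -/
def IsCocycle {N q : ℕ} (T : Eu N → Submodule ℂ (Eu N →L[ℝ] ℂ)) (Ω : Set (Eu N))
    (f : DForm N q) : Prop :=
  ∀ x ∈ Ω, extDeriv f x ∈ idealPart (T x) 1 (q + 1)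

/-- The space `G^s_0(K, C; Λ^{m,r})`, `k = m + r`. -/
def IsTestFormIn {N k : ℕ} (T : Eu N → Submodule ℂ (Eu N →L[ℝ] ℂ)) (m : ℕ) (s C : ℝ)
    (K : Set (Eu N)) (v : DForm N k) : Prop :=
  ContDiff ℝ ∞ v ∧ Function.support v ⊆ K ∧ (∀ x, v x ∈ idealPart (T x) m k) ∧
    formNorm s C K v < ⊤

/-- The space `G^s_0(Ω; Λ^{m,r})`, `k = m + r`: the union of the spaces `G^s_0(K, C; Λ^{m,r})` over
the compact sets `K ⊆ Ω` and the constants `C > 0`. -/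
def IsTestForm {N k : ℕ} (T : Eu N → Submodule ℂ (Eu N →L[ℝ] ℂ)) (m : ℕ) (s : ℝ)
    (Ω : Set (Eu N)) (v : DForm N k) : Prop :=
  ∃ K ⊆ Ω, IsCompact K ∧ ∃ C : ℝ, 0 < C ∧ IsTestFormIn T m s C K v

/-- Ultracurrents in `D'_s(Ω; Λ^{0,n-r})`, as the dual of `G^s_0(Ω; Λ^{m,r})`, `k = m + r`: linear
functionals on that space whose restriction to every `G^s_0(K, C; Λ^{m,r})` is bounded. Only the
values of `u` on test forms matter. -/
def IsUltracurrent {N k : ℕ} (T : Eu N → Submodule ℂ (Eu N →L[ℝ] ℂ)) (m : ℕ) (s : ℝ)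
    (Ω : Set (Eu N)) (u : DForm N k → ℂ) : Prop :=
  (∀ v w : DForm N k, IsTestForm T m s Ω v → IsTestForm T m s Ω w → u (v + w) = u v + u w) ∧
  (∀ (c : ℂ) (v : DForm N k), IsTestForm T m s Ω v → u (c • v) = c * u v) ∧
  ∀ K ⊆ Ω, IsCompact K → ∀ C : ℝ, 0 < C → ∃ C' : ℝ, 0 < C' ∧
    ∀ v : DForm N k, IsTestFormIn T m s C K v →
      ENNReal.ofReal ‖u v‖ ≤ ENNReal.ofReal C' * formNorm s C K v

/-- `d'u = f` in `Ω`, for an ultracurrent `u` of type `(0, q-1)` and a form `f` of type `(0, q)`: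
`⟨d'u, v⟩ = (-1)^q ⟨u, d'v⟩` equals `∫_Ω f ∧ v` for all `v ∈ G^s_0(Ω; Λ^{m,n-q})`. -/
def SolvesOn {N q k : ℕ} (h : q + k = N) (T : Eu N → Submodule ℂ (Eu N →L[ℝ] ℂ)) (m : ℕ)
    (s : ℝ) (Ω : Set (Eu N)) (u : DForm N (k + 1) → ℂ) (f : DForm N q) : Prop :=
  ∀ v : DForm N k, IsTestForm T m s Ω v →
    (-1) ^ q * u (extDeriv v) = ∫ x in Ω, topWedge h (f x) (v x)

/-- The complex `d'` defined by `T` in the open set `D` is locally solvable near `y₀ ∈ D` in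
degree `q` in the sense of ultradistributions of order `s`; here `k = N - q`. -/
def LocallySolvable {N q k : ℕ} (h : q + k = N) (T : Eu N → Submodule ℂ (Eu N →L[ℝ] ℂ)) (m : ℕ)
    (s : ℝ) (D : Set (Eu N)) (y₀ : Eu N) : Prop :=
  ∃ U : Set (Eu N), IsOpen U ∧ y₀ ∈ U ∧ U ⊆ D ∧
    ∀ Ω : Set (Eu N), IsOpen Ω → y₀ ∈ Ω → Ω ⊆ U →
      ∀ f : DForm N q, IsGevreyFormSome s Ω f → IsCocycle T Ω f →
        ∃ V : Set (Eu N), IsOpen V ∧ y₀ ∈ V ∧ V ⊆ Ω ∧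
          ∃ u : DForm N (k + 1) → ℂ, IsUltracurrent T m s V u ∧ SolvesOn h T m s V u f

end

noncomputable section

/-! ### The wedge product with a covector -/

section Wedge

variable {N k : ℕ}

/-! The estimate is a uniform boundedness principle. If a cocycle `f` equals `d'u` near the base
point, then up to sign its pairing with `v` is `⟨u, d'v⟩`, and the continuity of `u` bounds it by a
constant times the norm of `d'v`. The constant and the neighbourhood depend on `f`, and Baire's
theorem makes them uniform.

For this `d'` must map test forms to test forms. An increase of the Gevrey constant from `C₂ - ε` to
`C₂` absorbs the lost derivative (`formNorm_extDeriv_lt_top`). That `dv` stays in the top power of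
the ideal of `T'` uses integrability. A count of ranks shows that the `m` exact differentials
spanning `T'` are independent (`exists_exact_frame`), and for independent covectors the top power
consists of the forms killed by each of them. If `dZᵢ ∧ v = 0`, then `d(Zᵢ v) = Zᵢ dv`, and a second
`d` gives `dZᵢ ∧ dv = 0` (`extDeriv_mem_idealPart`).

Baire's theorem is applied in `ℓ¹` instead of the Fréchet space of cocycles. If the estimate fails,
there are cocycles `f_j` of norm at most 1 on the `j`-th set of a compact exhaustion, and test forms
`v_j` supported in balls shrinking to the base point, which violate it with constant `j + 1`. For
every `a` in `ℓ¹` the sum `∑ a_j f_j` is a Gevrey cocycle (`isGevreyFormSome_tsum`,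
`isCocycle_tsum`). Solving the equation for each sum and applying
`exists_uniform_bound_of_pointwise_bound` bounds all pairings of the `f_i` with the test forms in
one fixed ball by a single constant, which contradicts the choice of `v_j` for large `j`. -/

theorem covectorWedge_apply (ζ : Eu N →L[ℝ] ℂ) (b : (Eu N) [⋀^Fin k]→L[ℝ] ℂ)
    (v : Fin (k + 1) → Eu N) :
    covectorWedge ζ b v =
      ∑ i : Fin (k + 1), (-1) ^ (i : ℕ) * (ζ (v i) * b (i.removeNth v)) := by
  simp [covectorWedge, ContinuousAlternatingMap.alternatizeUncurryFin_apply, zsmul_eq_mul]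

theorem covectorWedge_add_left (ζ η : Eu N →L[ℝ] ℂ) (b : (Eu N) [⋀^Fin k]→L[ℝ] ℂ) :
    covectorWedge (ζ + η) b = covectorWedge ζ b + covectorWedge η b := by
  ext v
  simp [covectorWedge_apply, add_mul, mul_add, Finset.sum_add_distrib]

theorem covectorWedge_smul_left (c : ℂ) (ζ : Eu N →L[ℝ] ℂ) (b : (Eu N) [⋀^Fin k]→L[ℝ] ℂ) :
    covectorWedge (c • ζ) b = c • covectorWedge ζ b := by
  ext v
  simp only [covectorWedge_apply, ContinuousAlternatingMap.smul_apply, smul_eq_mul,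
    smul_apply, Finset.mul_sum]
  exact Finset.sum_congr rfl fun i _ => by ring

theorem covectorWedge_add_right (ζ : Eu N →L[ℝ] ℂ) (a b : (Eu N) [⋀^Fin k]→L[ℝ] ℂ) :
    covectorWedge ζ (a + b) = covectorWedge ζ a + covectorWedge ζ b := by
  ext v
  simp [covectorWedge_apply, mul_add, Finset.sum_add_distrib]

theorem covectorWedge_smul_right (c : ℂ) (ζ : Eu N →L[ℝ] ℂ) (b : (Eu N) [⋀^Fin k]→L[ℝ] ℂ) :
    covectorWedge ζ (c • b) = c • covectorWedge ζ b := by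
  ext v
  simp only [covectorWedge_apply, ContinuousAlternatingMap.smul_apply, smul_eq_mul,
    Finset.mul_sum]
  exact Finset.sum_congr rfl fun i _ => by ring

/-- `ζ ∧ b` as a bilinear map. -/
def covectorWedgeₗ : (Eu N →L[ℝ] ℂ) →ₗ[ℂ] ((Eu N) [⋀^Fin k]→L[ℝ] ℂ) →ₗ[ℂ]
    ((Eu N) [⋀^Fin (k + 1)]→L[ℝ] ℂ) :=
  LinearMap.mk₂ ℂ covectorWedge covectorWedge_add_left covectorWedge_smul_left
    covectorWedge_add_right (fun c ζ b => covectorWedge_smul_right c ζ b)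

theorem covectorWedgeₗ_apply (ζ : Eu N →L[ℝ] ℂ) (b : (Eu N) [⋀^Fin k]→L[ℝ] ℂ) :
    covectorWedgeₗ ζ b = covectorWedge ζ b := rfl

/-- The bilinear map `(x, y) ↦ ζ(x) ζ(y) b` is symmetric, so its double alternatization vanishes. -/
theorem covectorWedge_self (ζ : Eu N →L[ℝ] ℂ) (b : (Eu N) [⋀^Fin k]→L[ℝ] ℂ) :
    covectorWedge ζ (covectorWedge ζ b) = 0 := by
  let B : Eu N →L[ℝ] Eu N →L[ℝ] (Eu N) [⋀^Fin k]→L[ℝ] ℂ :=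
    (ContinuousLinearMap.compL ℝ (Eu N) ℂ _ ((ContinuousLinearMap.id ℝ ℂ).smulRight b)) ∘L
      ((ContinuousLinearMap.mul ℝ ℂ).bilinearComp ζ ζ)
  have hB : ∀ x y, B x y = (ζ x * ζ y) • b := fun x y => by simp [B]
  have hw : ContinuousAlternatingMap.alternatizeUncurryFinCLM ℝ (Eu N) ℂ ∘L B =
      ζ.smulRight (covectorWedge ζ b) := by
    ext x v
    simp only [ContinuousLinearMap.comp_apply,
      ContinuousAlternatingMap.alternatizeUncurryFinCLM_apply,
      ContinuousLinearMap.smulRight_apply, ContinuousAlternatingMap.smul_apply, smul_eq_mul,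
      covectorWedge_apply, ContinuousAlternatingMap.alternatizeUncurryFin_apply, hB, zsmul_eq_mul,
      Finset.mul_sum]
    exact Finset.sum_congr rfl fun i _ => by push_cast; ring
  have key :=
    ContinuousAlternatingMap.alternatizeUncurryFin_alternatizeUncurryFinCLM_comp_of_symmetric
      (f := B) (fun x y => by rw [hB, hB, mul_comm])
  rwa [hw] at key

theorem covectorWedge_anticomm (ζ η : Eu N →L[ℝ] ℂ) (b : (Eu N) [⋀^Fin k]→L[ℝ] ℂ) :
    covectorWedge ζ (covectorWedge η b) = -covectorWedge η (covectorWedge ζ b) := by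
  have h := covectorWedge_self (ζ + η) b
  simp only [covectorWedge_add_left, covectorWedge_add_right, covectorWedge_self, zero_add,
    add_zero] at h
  exact eq_neg_of_add_eq_zero_right h

/-- The contraction of a complex form with the complex vector `a + ib`. -/
def contract (a b : Eu N) (w : (Eu N) [⋀^Fin (k + 1)]→L[ℝ] ℂ) : (Eu N) [⋀^Fin k]→L[ℝ] ℂ :=
  w.curryLeft a + Complex.I • w.curryLeft b

theorem curryLeft_covectorWedge (ζ : Eu N →L[ℝ] ℂ) (a : Eu N)
    (w : (Eu N) [⋀^Fin (k + 1)]→L[ℝ] ℂ) :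
    (covectorWedge ζ w).curryLeft a = ζ a • w - covectorWedge ζ (w.curryLeft a) := by
  ext v
  simp only [ContinuousAlternatingMap.curryLeft_apply_apply, covectorWedge_apply,
    ContinuousAlternatingMap.sub_apply, ContinuousAlternatingMap.smul_apply, smul_eq_mul]
  rw [Fin.sum_univ_succ, sub_eq_add_neg, ← Finset.sum_neg_distrib]
  congr 1
  · simp [Matrix.vecCons]
  · refine Finset.sum_congr rfl fun i _ => ?_
    have : i.succ.removeNth (Matrix.vecCons a v) = Matrix.vecCons a (i.removeNth v) := by
      funext j
      refine Fin.cases ?_ (fun j => ?_) j <;> simp [Fin.removeNth, Fin.succ_succAbove_succ]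
    rw [this]
    simp [pow_succ]

theorem curryLeft_covectorWedge_zero (ζ : Eu N →L[ℝ] ℂ) (a : Eu N)
    (w : (Eu N) [⋀^Fin 0]→L[ℝ] ℂ) : (covectorWedge ζ w).curryLeft a = ζ a • w := by
  ext v
  simp [covectorWedge_apply, Matrix.vecCons]

/-- Contraction is an antiderivation. This is what allows a covector to be divided out of a form. -/
theorem contract_covectorWedge (ζ : Eu N →L[ℝ] ℂ) (a b : Eu N)
    (w : (Eu N) [⋀^Fin (k + 1)]→L[ℝ] ℂ) :
    contract a b (covectorWedge ζ w) =
      (ζ a + Complex.I * ζ b) • w - covectorWedge ζ (contract a b w) := by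
  simp only [contract, curryLeft_covectorWedge, covectorWedge_add_right,
    covectorWedge_smul_right]
  ext v
  simp only [ContinuousAlternatingMap.add_apply, ContinuousAlternatingMap.sub_apply,
    ContinuousAlternatingMap.smul_apply, smul_eq_mul]
  ring

theorem contract_covectorWedge_zero (ζ : Eu N →L[ℝ] ℂ) (a b : Eu N)
    (w : (Eu N) [⋀^Fin 0]→L[ℝ] ℂ) :
    contract a b (covectorWedge ζ w) = (ζ a + Complex.I * ζ b) • w := by
  simp only [contract, curryLeft_covectorWedge_zero]
  ext v
  simp only [ContinuousAlternatingMap.add_apply, ContinuousAlternatingMap.smul_apply, smul_eq_mul]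
  ring

theorem contract_zero (a b : Eu N) : contract a b (0 : (Eu N) [⋀^Fin (k + 1)]→L[ℝ] ℂ) = 0 := by
  ext v
  simp [contract]

end Wedge

/-! ### Powers of the ideal spanned by independent covectors -/

section Ideal

variable {N : ℕ}

theorem covectorWedge_mem_idealPart {W : Submodule ℂ (Eu N →L[ℝ] ℂ)} {p k : ℕ}
    {ζ : Eu N →L[ℝ] ℂ} (hζ : ζ ∈ W) {b : (Eu N) [⋀^Fin k]→L[ℝ] ℂ} (hb : b ∈ idealPart W p k) :
    covectorWedge ζ b ∈ idealPart W (p + 1) (k + 1) :=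
  Submodule.subset_span ⟨ζ, hζ, b, hb, rfl⟩

theorem idealPart_succ_le (W : Submodule ℂ (Eu N →L[ℝ] ℂ)) (p k : ℕ) :
    idealPart W (p + 1) k ≤ idealPart W p k := by
  induction p generalizing k with
  | zero => exact le_top
  | succ p ih =>
    cases k with
    | zero => exact bot_le
    | succ k =>
      refine Submodule.span_le.2 ?_
      rintro _ ⟨ζ, hζ, b, hb, rfl⟩
      exact covectorWedge_mem_idealPart hζ (ih k hb)

theorem idealPart_mono {W W' : Submodule ℂ (Eu N →L[ℝ] ℂ)} (h : W ≤ W') (p k : ℕ) :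
    idealPart W p k ≤ idealPart W' p k := by
  induction p generalizing k with
  | zero => exact le_top
  | succ p ih =>
    cases k with
    | zero => exact bot_le
    | succ k =>
      refine Submodule.span_le.2 ?_
      rintro _ ⟨ζ, hζ, b, hb, rfl⟩
      exact covectorWedge_mem_idealPart (h hζ) (ih k hb)

/-- Splitting one generator off a power of the ideal. -/
theorem idealPart_span_sup (ζ₀ : Eu N →L[ℝ] ℂ) (W : Submodule ℂ (Eu N →L[ℝ] ℂ)) (p k : ℕ)
    {w : (Eu N) [⋀^Fin (k + 1)]→L[ℝ] ℂ} (hw : w ∈ idealPart (ℂ ∙ ζ₀ ⊔ W) (p + 1) (k + 1)) :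
    ∃ a ∈ idealPart W p k, ∃ b ∈ idealPart W (p + 1) (k + 1), w = covectorWedge ζ₀ a + b := by
  induction p generalizing k with
  | zero =>
    induction hw using Submodule.span_induction with
    | mem w hw =>
      obtain ⟨ζ, hζ, b, -, rfl⟩ := hw
      obtain ⟨_, h0, η, hη, rfl⟩ := Submodule.mem_sup.1 hζ
      obtain ⟨c, rfl⟩ := Submodule.mem_span_singleton.1 h0
      refine ⟨c • b, trivial, covectorWedge η b, covectorWedge_mem_idealPart hη trivial, ?_⟩
      rw [covectorWedge_add_left, covectorWedge_smul_left, covectorWedge_smul_right]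
    | zero => exact ⟨0, zero_mem _, 0, zero_mem _, by rw [← covectorWedgeₗ_apply]; simp⟩
    | add x y _ _ hx hy =>
      obtain ⟨a, ha, b, hb, rfl⟩ := hx
      obtain ⟨a', ha', b', hb', rfl⟩ := hy
      exact ⟨a + a', add_mem ha ha', b + b', add_mem hb hb', by
        rw [covectorWedge_add_right]; abel⟩
    | smul c x _ hx =>
      obtain ⟨a, ha, b, hb, rfl⟩ := hx
      exact ⟨c • a, Submodule.smul_mem _ _ ha, c • b, Submodule.smul_mem _ _ hb, by
        rw [covectorWedge_smul_right, smul_add]⟩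
  | succ p ih =>
    induction hw using Submodule.span_induction with
    | mem w hw =>
      obtain ⟨ζ, hζ, b, hb, rfl⟩ := hw
      obtain ⟨_, h0, η, hη, rfl⟩ := Submodule.mem_sup.1 hζ
      obtain ⟨c, rfl⟩ := Submodule.mem_span_singleton.1 h0
      cases k with
      | zero =>
        obtain rfl : b = 0 := hb
        exact ⟨0, zero_mem _, 0, zero_mem _, by simp only [← covectorWedgeₗ_apply]; simp⟩
      | succ k =>
        obtain ⟨b₁, hb₁, b₂, hb₂, rfl⟩ := ih k hb
        -- With `ζ = c ζ₀ + η` and `b = ζ₀ ∧ b₁ + b₂`, the term `c ζ₀ ∧ ζ₀ ∧ b₁` vanishes and `η ∧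
        -- ζ₀ ∧ b₁ = -ζ₀ ∧ η ∧ b₁`.
        refine ⟨c • b₂ - covectorWedge η b₁, sub_mem (Submodule.smul_mem _ _ hb₂)
          (covectorWedge_mem_idealPart hη hb₁), covectorWedge η b₂,
          covectorWedge_mem_idealPart hη hb₂, ?_⟩
        have h1 := covectorWedge_anticomm η ζ₀ b₁
        have h2 := covectorWedge_self ζ₀ b₁
        simp only [← covectorWedgeₗ_apply] at h1 h2 ⊢
        simp only [map_add, map_sub, map_smul, LinearMap.add_apply, LinearMap.smul_apply, h1, h2]
        simp only [smul_zero]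
        abel
    | zero => exact ⟨0, zero_mem _, 0, zero_mem _, by rw [← covectorWedgeₗ_apply]; simp⟩
    | add x y _ _ hx hy =>
      obtain ⟨a, ha, b, hb, rfl⟩ := hx
      obtain ⟨a', ha', b', hb', rfl⟩ := hy
      exact ⟨a + a', add_mem ha ha', b + b', add_mem hb hb', by
        rw [covectorWedge_add_right]; abel⟩
    | smul c x _ hx =>
      obtain ⟨a, ha, b, hb, rfl⟩ := hx
      exact ⟨c • a, Submodule.smul_mem _ _ ha, c • b, Submodule.smul_mem _ _ hb, by
        rw [covectorWedge_smul_right, smul_add]⟩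

/-- A product of `j + 1` factors from the span of `j` covectors vanishes. Peeling off `ζ 0` leaves
too many factors from the remaining `j - 1` covectors. -/
theorem idealPart_span_range_eq_bot {j : ℕ} (ζ : Fin j → Eu N →L[ℝ] ℂ) (k : ℕ) :
    idealPart (Submodule.span ℂ (Set.range ζ)) (j + 1) k = ⊥ := by
  induction j generalizing k with
  | zero =>
    cases k with
    | zero => rfl
    | succ k =>
      refine Submodule.span_eq_bot.2 ?_
      rintro _ ⟨η, hη, b, -, rfl⟩
      have : η = 0 := by simpa [Set.range_eq_empty] using hη
      rw [this, ← covectorWedgeₗ_apply]; simp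
  | succ j ih =>
    cases k with
    | zero => rfl
    | succ k =>
      have hspan : Submodule.span ℂ (Set.range ζ) =
          ℂ ∙ ζ 0 ⊔ Submodule.span ℂ (Set.range fun i : Fin j => ζ i.succ) := by
        rw [← Submodule.span_union, ← Set.insert_eq]
        congr 1
        exact (Fin.range_cons (ζ 0) (fun i : Fin j => ζ i.succ)) ▸
          congrArg Set.range (Fin.cons_self_tail ζ).symm
      rw [eq_bot_iff, hspan]
      intro w hw
      obtain ⟨a, ha, b, hb, rfl⟩ := idealPart_span_sup _ _ _ _ hw
      rw [ih] at ha
      have hb' := idealPart_succ_le _ _ _ hb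
      rw [ih] at hb'
      rw [(Submodule.mem_bot ℂ).1 ha, (Submodule.mem_bot ℂ).1 hb', ← covectorWedgeₗ_apply]
      simp

theorem covectorWedge_eq_zero_of_mem_idealPart {m k : ℕ} (ζ : Fin m → Eu N →L[ℝ] ℂ)
    {w : (Eu N) [⋀^Fin k]→L[ℝ] ℂ}
    (hw : w ∈ idealPart (Submodule.span ℂ (Set.range ζ)) m k) (i : Fin m) :
    covectorWedge (ζ i) w = 0 := by
  have := covectorWedge_mem_idealPart (Submodule.subset_span (Set.mem_range_self i)) hw
  rwa [idealPart_span_range_eq_bot, Submodule.mem_bot] at this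

/-- Covectors that admit a dual family of complex vectors `a + ib`: a form annihilated by the wedge
product with each of them belongs to the top power of their ideal. -/
theorem mem_idealPart_of_covectorWedge_eq_zero {m k : ℕ} (ζ : Fin m → Eu N →L[ℝ] ℂ)
    (a b : Fin m → Eu N)
    (hdual : ∀ i j, ζ i (a j) + Complex.I * ζ i (b j) = if i = j then 1 else 0)
    {w : (Eu N) [⋀^Fin k]→L[ℝ] ℂ} (hw : ∀ i, covectorWedge (ζ i) w = 0) :
    w ∈ idealPart (Submodule.span ℂ (Set.range ζ)) m k := by
  induction m generalizing k with
  | zero => trivial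
  | succ m ih =>
    cases k with
    | zero =>
      have h := contract_covectorWedge_zero (ζ 0) (a 0) (b 0) w
      rw [hw 0, contract_zero, hdual, if_pos rfl, one_smul] at h
      rw [← h]; exact zero_mem _
    | succ k =>
      have h := contract_covectorWedge (ζ 0) (a 0) (b 0) w
      rw [hw 0, contract_zero, hdual, if_pos rfl, one_smul] at h
      -- Contracting `ζ₀ ∧ w = 0` with the dual vector gives `w = ζ₀ ∧ ι₀w`. The other `ζᵢ`
      -- annihilate `ι₀w`, because they vanish on that vector, so induction applies to `ι₀w`.
      rw [sub_eq_zero.1 h.symm]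
      refine covectorWedge_mem_idealPart (Submodule.subset_span (Set.mem_range_self 0)) ?_
      refine idealPart_mono (Submodule.span_mono ?_) _ _ (ih (fun i => ζ i.succ)
        (fun i => a i.succ) (fun i => b i.succ) (fun i j => by simp [hdual]) (fun i => ?_))
      · rintro _ ⟨i, rfl⟩; exact ⟨i.succ, rfl⟩
      · have h := contract_covectorWedge (ζ i.succ) (a 0) (b 0) w
        rw [hw, contract_zero, hdual, if_neg (Fin.succ_ne_zero i)] at h
        have h0 : (0 : ℂ) • w = 0 := by ext; simp
        rw [h0, zero_sub] at h
        exact neg_eq_zero.1 h.symm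

end Ideal

/-! ### Exact local frames of `T'` -/

section Frame

variable {N : ℕ}

/-- Complex-linearly independent covectors admit a dual family of complex vectors `a + ib`. -/
theorem exists_dual_of_linearIndependent {m : ℕ} {ζ : Fin m → Eu N →L[ℝ] ℂ}
    (hζ : LinearIndependent ℂ ζ) :
    ∃ a b : Fin m → Eu N,
      ∀ i j, ζ i (a j) + Complex.I * ζ i (b j) = if i = j then 1 else 0 := by
  -- `P` is the range of the joint evaluation of the `ζᵢ` on complex vectors. Were it proper, a
  -- nonzero functional vanishing on it would be a linear relation between the `ζᵢ`.
  let P : Submodule ℂ (Fin m → ℂ) :=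
    { carrier := {c | ∃ a b : Eu N, ∀ i, c i = ζ i a + Complex.I * ζ i b}
      zero_mem' := ⟨0, 0, by simp⟩
      add_mem' := by
        rintro _ _ ⟨a, b, h⟩ ⟨a', b', h'⟩
        exact ⟨a + a', b + b', fun i => by simp only [Pi.add_apply, h, h', map_add]; ring⟩
      smul_mem' := by
        rintro c _ ⟨a, b, h⟩
        refine ⟨c.re • a - c.im • b, c.re • b + c.im • a, fun i => ?_⟩
        simp only [Pi.smul_apply, h, map_add, map_sub, map_smul, smul_eq_mul, Complex.real_smul]
        conv_lhs => rw [← Complex.re_add_im c]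
        linear_combination (c.im : ℂ) * ζ i b * Complex.I_mul_I }
  have hP : P = ⊤ := by
    by_contra hne
    obtain ⟨f, hf, hle⟩ := Submodule.exists_le_ker_of_lt_top P (lt_top_iff_ne_top.2 hne)
    apply hf
    have hsum : ∀ c, f c = ∑ i, c i * f (Pi.single i 1) := fun c => by
      conv_lhs => rw [pi_eq_sum_univ' c, map_sum]
      simp
    have h0 : ∑ i, f (Pi.single i 1) • ζ i = 0 := by
      ext x
      have h1 : (fun i => ζ i x) ∈ P := ⟨x, 0, by simp⟩
      have h2 := LinearMap.mem_ker.1 (hle h1)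
      rw [hsum] at h2
      simpa [mul_comm] using h2
    have h3 := Fintype.linearIndependent_iff.1 hζ _ h0
    ext i
    simpa using h3 i
  have hmem : ∀ j : Fin m, (Pi.single j 1 : Fin m → ℂ) ∈ P := fun j => hP ▸ trivial
  choose a b hab using hmem
  exact ⟨a, b, fun i j => by rw [← hab j i, Pi.single_apply]⟩

end Frame

/-! ### Rank of the annihilator of a complex tangent subspace. -/

section Annihilator

variable {N : ℕ} {M : Type*} [TopologicalSpace M] [ChartedSpace (Eu N) M]

/-- The pairing of complex covectors and complex tangent vectors, as a bilinear map. -/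
def cPairₗ (x : M) : CCotangent N x →ₗ[ℂ] Module.Dual ℂ (CTangent N x) where
  toFun := cPair
  map_add' a b := by
    simp only [cPair, ← map_add]; rfl
  map_smul' c a := by
    simp only [cPair, RingHom.id_apply, ← map_smul]; rfl

/-- Extension of scalars identifies real-linear maps into `ℂ` with the complex dual of the
complexification, and continuity is automatic in finite dimension. -/
theorem cPairₗ_bijective (x : M) : Function.Bijective (cPairₗ (N := N) x) := by
  have : FiniteDimensional ℝ (TangentSpace 𝓘(ℝ, Eu N) x) :=
    inferInstanceAs (FiniteDimensional ℝ (Eu N))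
  constructor
  · intro a b h
    have := (LinearMap.liftBaseChangeEquiv ℂ).injective h
    ext v
    exact LinearMap.congr_fun this v
  · intro f
    obtain ⟨g, rfl⟩ := (LinearMap.liftBaseChangeEquiv (R := ℝ)
      (M := TangentSpace 𝓘(ℝ, Eu N) x) (N := ℂ) ℂ).surjective f
    let g' : Eu N →ₗ[ℝ] ℂ := g
    exact ⟨(LinearMap.toContinuousLinearMap g' : Eu N →L[ℝ] ℂ), rfl⟩

theorem finrank_annihilator_add {x : M} (V : Submodule ℂ (CTangent N x)) :
    Module.finrank ℂ V + Module.finrank ℂ (annihilator V) = N := by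
  have : FiniteDimensional ℝ (TangentSpace 𝓘(ℝ, Eu N) x) :=
    inferInstanceAs (FiniteDimensional ℝ (Eu N))
  let e := LinearEquiv.ofBijective (cPairₗ (N := N) x) (cPairₗ_bijective x)
  have h1 : annihilator V = V.dualAnnihilator.comap e.toLinearMap := by
    ext ζ
    simp only [Submodule.mem_comap, Submodule.mem_dualAnnihilator]
    rfl
  have h2 : Module.finrank ℂ (annihilator V) = Module.finrank ℂ V.dualAnnihilator := by
    rw [h1]
    exact (e.submoduleMap _).finrank_eq.trans (by
      rw [Submodule.map_comap_eq_of_surjective e.surjective])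
  rw [h2, Subspace.finrank_add_finrank_dualAnnihilator_eq]
  have : Module.finrank ℝ (TangentSpace 𝓘(ℝ, Eu N) x) = N :=
    finrank_euclideanSpace_fin (𝕜 := ℝ) (n := N)
  rw [Module.finrank_baseChange, this]

theorem mdifferentiable_of_mem_maximalAtlas_analytic {φ : OpenPartialHomeomorph M (Eu N)}
    (hφ : φ ∈ IsManifold.maximalAtlas 𝓘(ℝ, Eu N) ω M) :
    φ.MDifferentiable 𝓘(ℝ, Eu N) 𝓘(ℝ, Eu N) :=
  ⟨(contMDiffOn_of_mem_maximalAtlas hφ).mdifferentiableOn (by simp),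
    (contMDiffOn_symm_of_mem_maximalAtlas hφ).mdifferentiableOn (by simp)⟩

end Annihilator

/-! ### The bundle `T'` transported to a chart. -/

section ChartPullback

variable {m n : ℕ} {M : Type*} [TopologicalSpace M] [ChartedSpace (Eu (m + n)) M]

theorem chartPullback_injective {φ : OpenPartialHomeomorph M (Eu (m + n))}
    (hφ : φ ∈ IsManifold.maximalAtlas 𝓘(ℝ, Eu (m + n)) ω M) {y : Eu (m + n)}
    (hy : y ∈ φ.target) : Function.Injective (chartPullback φ (φ.symm y)) := by
  intro a b hab
  have h := (mdifferentiable_of_mem_maximalAtlas_analytic hφ).comp_symm_deriv hy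
  ext v
  have h1 := DFunLike.congr_fun hab (mfderiv 𝓘(ℝ, Eu (m + n)) 𝓘(ℝ, Eu (m + n)) φ.symm y v)
  have h2 := DFunLike.congr_fun h v
  change a (mfderiv 𝓘(ℝ, Eu (m + n)) 𝓘(ℝ, Eu (m + n)) φ (φ.symm y) _) =
    b (mfderiv 𝓘(ℝ, Eu (m + n)) 𝓘(ℝ, Eu (m + n)) φ (φ.symm y) _) at h1
  erw [h2] at h1
  exact h1

end ChartPullback

section InChart

variable {m n : ℕ} {M : Type*} [TopologicalSpace M] [ChartedSpace (Eu (m + n)) M]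
  [IsManifold 𝓘(ℝ, Eu (m + n)) ω M]

theorem LocallyIntegrableStructure.finrank_T' (S : LocallyIntegrableStructure m n M) (x : M) :
    Module.finrank ℂ (S.T' x) = m := by
  obtain ⟨U, -, hx, X, Y, -, h⟩ := S.analytic_subbundle x
  obtain ⟨hli, hV⟩ := h x hx
  have h1 : Module.finrank ℂ (S.V x) = n := by
    rw [hV, finrank_span_eq_card hli, Fintype.card_fin]
  have h2 := finrank_annihilator_add (S.V x)
  rw [h1] at h2
  change Module.finrank ℂ (annihilator (S.V x)) = m
  omega

/-- The functions are the given first integrals composed with `φ⁻¹`. The structure only provides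
that their differentials span; independence follows because `m` covectors span a space of dimension
`m`. -/
theorem LocallyIntegrableStructure.exists_exact_frame (S : LocallyIntegrableStructure m n M)
    {φ : OpenPartialHomeomorph M (Eu (m + n))}
    (hφ : φ ∈ IsManifold.maximalAtlas 𝓘(ℝ, Eu (m + n)) ω M) {y : Eu (m + n)}
    (hy : y ∈ φ.target) :
    ∃ O : Set (Eu (m + n)), IsOpen O ∧ y ∈ O ∧ ∃ Z : Fin m → Eu (m + n) → ℂ,
      (∀ i, ContDiffOn ℝ ∞ (Z i) O) ∧ ∀ z ∈ O,
        S.inChart φ z = Submodule.span ℂ (Set.range fun i => fderiv ℝ (Z i) z) ∧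
        LinearIndependent ℂ (fun i => fderiv ℝ (Z i) z) := by
  obtain ⟨U, hU, hyU, Z, hZ, hspan⟩ := S.locally_exact (φ.symm y)
  have hO : IsOpen (φ.target ∩ φ.symm ⁻¹' U) := φ.isOpen_inter_preimage_symm hU
  have hsmooth : ∀ i, ContDiffOn ℝ ∞ (Z i ∘ φ.symm) (φ.target ∩ φ.symm ⁻¹' U) := fun i =>
    contMDiffOn_iff_contDiffOn.1 ((hZ i).comp
      (((contMDiffOn_symm_of_mem_maximalAtlas hφ).of_le le_top).mono Set.inter_subset_left)
      (fun z hz => hz.2))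
  refine ⟨_, hO, ⟨hy, hyU⟩, fun i => Z i ∘ φ.symm, hsmooth, fun z hz => ?_⟩
  have hpull : ∀ i, chartPullback φ (φ.symm z) (fderiv ℝ (Z i ∘ φ.symm) z) =
      (mfderiv 𝓘(ℝ, Eu (m + n)) 𝓘(ℝ, ℂ) (Z i) (φ.symm z) : CCotangent (m + n) (φ.symm z)) := by
    intro i
    have hev : Z i =ᶠ[nhds (φ.symm z)] (Z i ∘ φ.symm) ∘ φ := by
      filter_upwards [φ.open_source.mem_nhds (φ.map_target hz.1)] with x hx
      simp [φ.left_inv hx]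
    rw [hev.mfderiv_eq, mfderiv_comp (I' := 𝓘(ℝ, Eu (m + n))) (φ.symm z), mfderiv_eq_fderiv,
      φ.right_inv hz.1]
    · rfl
    · rw [φ.right_inv hz.1]
      exact (((hsmooth i).contDiffAt (hO.mem_nhds hz)).differentiableAt (by simp)).mdifferentiableAt
    · exact (mdifferentiable_of_mem_maximalAtlas_analytic hφ).mdifferentiableAt
        (φ.map_target hz.1)
  have hT : S.T' (φ.symm z) = (Submodule.span ℂ
      (Set.range fun i => fderiv ℝ (Z i ∘ φ.symm) z)).map (chartPullback φ (φ.symm z)) := by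
    rw [Submodule.map_span, ← Set.range_comp]
    exact (hspan _ hz.2).trans (congrArg _ (congrArg _ (funext fun i => (hpull i).symm)))
  have hchart : S.inChart φ z =
      Submodule.span ℂ (Set.range fun i => fderiv ℝ (Z i ∘ φ.symm) z) := by
    rw [LocallyIntegrableStructure.inChart, hT]
    exact Submodule.comap_map_eq_of_injective (chartPullback_injective hφ hz.1) _
  refine ⟨hchart, linearIndependent_iff_card_eq_finrank_span.2 ?_⟩
  have h1 := S.finrank_T' (φ.symm z)
  rw [hT] at h1
  rw [Fintype.card_fin]
  exact h1.symm.trans (Submodule.equivMapOfInjective _ (chartPullback_injective hφ hz.1) _).finrank_eq.symm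

end InChart

/-! ### The exterior derivative and powers of the ideal of `T'` -/

section ExtDeriv

variable {N k : ℕ}

theorem extDeriv_fun_smul_covectorWedge {Z : Eu N → ℂ} {v : DForm N k} {x : Eu N}
    (hZ : DifferentiableAt ℝ Z x) (hv : DifferentiableAt ℝ v x) :
    extDeriv (fun y => Z y • v y) x = covectorWedge (fderiv ℝ Z x) (v x) + Z x • extDeriv v x := by
  rw [extDeriv, fderiv_fun_smul hZ hv, ContinuousAlternatingMap.alternatizeUncurryFin_add,
    ContinuousAlternatingMap.alternatizeUncurryFin_smul, add_comm (covectorWedge _ _)]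
  rfl

theorem contDiffAt_extDeriv {v : DForm N k} {x : Eu N} (hv : ContDiffAt ℝ ∞ v x) :
    ContDiffAt ℝ ∞ (extDeriv v) x := by
  let A : (Eu N →L[ℝ] (Eu N) [⋀^Fin k]→L[ℝ] ℂ) →L[ℝ] (Eu N) [⋀^Fin (k + 1)]→L[ℝ] ℂ :=
    ContinuousAlternatingMap.alternatizeUncurryFinCLM ℝ (Eu N) ℂ
  have hA : extDeriv v = A ∘ fderiv ℝ v := rfl
  rw [hA]
  exact A.contDiff.contDiffAt.comp x (hv.fderiv_right (m := ∞) (by simp))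

/-- If `T` is spanned by independent exact differentials, then the exterior derivative preserves
the top power of its ideal. -/
theorem extDeriv_mem_idealPart {m : ℕ} {O : Set (Eu N)} (hO : IsOpen O) {Z : Fin m → Eu N → ℂ}
    (hZ : ∀ i, ContDiffOn ℝ ∞ (Z i) O)
    (hli : ∀ z ∈ O, LinearIndependent ℂ (fun i => fderiv ℝ (Z i) z)) {v : DForm N k}
    (hv : ContDiffOn ℝ ∞ v O)
    (hmem : ∀ z ∈ O, v z ∈
      idealPart (Submodule.span ℂ (Set.range fun i => fderiv ℝ (Z i) z)) m k)
    {z : Eu N} (hz : z ∈ O) :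
    extDeriv v z ∈
      idealPart (Submodule.span ℂ (Set.range fun i => fderiv ℝ (Z i) z)) m (k + 1) := by
  obtain ⟨a, b, hab⟩ := exists_dual_of_linearIndependent (hli z hz)
  refine mem_idealPart_of_covectorWedge_eq_zero _ a b hab fun i => ?_
  have hZat : ∀ y ∈ O, ContDiffAt ℝ ∞ (Z i) y := fun y hy => (hZ i).contDiffAt (hO.mem_nhds hy)
  have hvat : ∀ y ∈ O, ContDiffAt ℝ ∞ v y := fun y hy => hv.contDiffAt (hO.mem_nhds hy)
  -- The Leibniz term `dZᵢ ∧ v` vanishes on all of `O`, so the identity holds near `z` and can be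
  -- differentiated once more.
  have h1 : extDeriv (fun y => Z i y • v y) =ᶠ[nhds z] fun y => Z i y • extDeriv v y := by
    filter_upwards [hO.mem_nhds hz] with y hy
    rw [extDeriv_fun_smul_covectorWedge ((hZat y hy).differentiableAt (by simp))
      ((hvat y hy).differentiableAt (by simp)),
      covectorWedge_eq_zero_of_mem_idealPart _ (hmem y hy) i, zero_add]
  have h2 := extDeriv_extDeriv_apply ((hZat z hz).smul (hvat z hz)) (by rw [minSmoothness_of_isRCLikeNormedField]; exact WithTop.coe_le_coe.2 (le_top : (2 : ℕ∞) ≤ ⊤))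
  have h3 := extDeriv_extDeriv_apply (hvat z hz) (by rw [minSmoothness_of_isRCLikeNormedField]; exact WithTop.coe_le_coe.2 (le_top : (2 : ℕ∞) ≤ ⊤))
  change extDeriv (extDeriv fun y => Z i y • v y) z = 0 at h2
  rw [h1.extDeriv_eq, extDeriv_fun_smul_covectorWedge ((hZat z hz).differentiableAt (by simp))
    ((contDiffAt_extDeriv (hvat z hz)).differentiableAt (by simp)), h3] at h2
  simpa using h2

theorem LocallyIntegrableStructure.extDeriv_mem_idealPart {m n : ℕ} {M : Type*}
    [TopologicalSpace M] [ChartedSpace (Eu (m + n)) M] [IsManifold 𝓘(ℝ, Eu (m + n)) ω M]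
    (S : LocallyIntegrableStructure m n M) {φ : OpenPartialHomeomorph M (Eu (m + n))}
    (hφ : φ ∈ IsManifold.maximalAtlas 𝓘(ℝ, Eu (m + n)) ω M) {v : DForm (m + n) k}
    (hv : ContDiff ℝ ∞ v) (hmem : ∀ x, v x ∈ idealPart (S.inChart φ x) m k)
    {y : Eu (m + n)} (hy : y ∈ φ.target) :
    extDeriv v y ∈ idealPart (S.inChart φ y) m (k + 1) := by
  obtain ⟨O, hO, hyO, Z, hZ, hZO⟩ := S.exists_exact_frame hφ hy
  rw [(hZO y hyO).1]
  refine _root_.extDeriv_mem_idealPart hO hZ (fun z hz => (hZO z hz).2) hv.contDiffOn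
    (fun z hz => ?_) hyO
  rw [← (hZO z hz).1]
  exact hmem z

end ExtDeriv

/-! ### Iterated partial derivatives -/

section Partials

variable {N : ℕ}

/-- The iterated partial derivative along a list of coordinates, the last one taken first. -/
def partials (l : List (Fin N)) (g : Eu N → ℂ) : Eu N → ℂ :=
  l.foldr (fun i h x => fderiv ℝ h x (stdVec i)) g

theorem partials_cons (i : Fin N) (l : List (Fin N)) (g : Eu N → ℂ) :
    partials (i :: l) g = fun x => fderiv ℝ (partials l g) x (stdVec i) := rfl

theorem partials_append (l l' : List (Fin N)) (g : Eu N → ℂ) :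
    partials (l ++ l') g = partials l (partials l' g) := List.foldr_append

variable {Ω : Set (Eu N)}

theorem contDiffOn_fderiv_apply (hΩ : IsOpen Ω) {g : Eu N → ℂ} (hg : ContDiffOn ℝ ∞ g Ω)
    (e : Eu N) : ContDiffOn ℝ ∞ (fun x => fderiv ℝ g x e) Ω :=
  (hg.fderiv_of_isOpen hΩ (by simp)).clm_apply contDiffOn_const

theorem contDiffOn_partials (hΩ : IsOpen Ω) {g : Eu N → ℂ} (hg : ContDiffOn ℝ ∞ g Ω)
    (l : List (Fin N)) : ContDiffOn ℝ ∞ (partials l g) Ω := by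
  induction l with
  | nil => exact hg
  | cons i l ih => exact contDiffOn_fderiv_apply hΩ ih _

theorem fderiv_fderiv_apply_comm (hΩ : IsOpen Ω) {g : Eu N → ℂ} (hg : ContDiffOn ℝ ∞ g Ω)
    (e e' : Eu N) {x : Eu N} (hx : x ∈ Ω) :
    fderiv ℝ (fun y => fderiv ℝ g y e) x e' = fderiv ℝ (fun y => fderiv ℝ g y e') x e := by
  have hat := hg.contDiffAt (hΩ.mem_nhds hx)
  have hd : DifferentiableAt ℝ (fderiv ℝ g) x :=
    (hat.fderiv_right (m := ∞) (by simp)).differentiableAt (by simp)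
  have h : ∀ a b : Eu N, fderiv ℝ (fun y => fderiv ℝ g y a) x b = fderiv ℝ (fderiv ℝ g) x b a := by
    intro a b
    rw [fderiv_clm_apply hd (differentiableAt_const a)]
    simp
  rw [h, h]
  exact (hat.isSymmSndFDerivAt (by
    rw [minSmoothness_of_isRCLikeNormedField]
    exact WithTop.coe_le_coe.2 (le_top : (2 : ℕ∞) ≤ ⊤))).eq _ _

/-- `multiDeriv` takes the coordinates in a fixed order. Symmetry of second derivatives handles
transpositions of neighbours, which generate all reorderings. -/
theorem partials_perm (hΩ : IsOpen Ω) {g : Eu N → ℂ} (hg : ContDiffOn ℝ ∞ g Ω)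
    {l l' : List (Fin N)} (h : l.Perm l') : Set.EqOn (partials l g) (partials l' g) Ω := by
  induction h with
  | nil => exact fun _ _ => rfl
  | cons i _ ih =>
    intro x hx
    simp only [partials_cons]
    rw [(ih.eventuallyEq_of_mem (hΩ.mem_nhds hx)).fderiv_eq]
  | swap i j l =>
    intro x hx
    exact fderiv_fderiv_apply_comm hΩ (contDiffOn_partials hΩ hg l) _ _ hx
  | trans _ _ h₁ h₂ => exact h₁.trans h₂

theorem iteratedFDeriv_apply_stdVec (hΩ : IsOpen Ω) {g : Eu N → ℂ} (hg : ContDiffOn ℝ ∞ g Ω)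
    {k : ℕ} (I : Fin k → Fin N) {x : Eu N} (hx : x ∈ Ω) :
    iteratedFDeriv ℝ k g x (fun j => stdVec (I j)) = partials (List.ofFn I) g x := by
  induction k generalizing x with
  | zero => simp [partials]
  | succ k ih =>
    have hd : DifferentiableAt ℝ (iteratedFDeriv ℝ k g) x :=
      (hg.contDiffAt (hΩ.mem_nhds hx)).differentiableAt_iteratedFDeriv
        (WithTop.coe_lt_coe.2 (WithTop.coe_lt_top k))
    have hev : partials (List.ofFn fun j => I (Fin.succ j)) g =ᶠ[nhds x]
        fun y => iteratedFDeriv ℝ k g y (fun j => stdVec (I (Fin.succ j))) := by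
      filter_upwards [hΩ.mem_nhds hx] with y hy
      exact (ih (fun j => I j.succ) hy).symm
    rw [iteratedFDeriv_succ_apply_left, List.ofFn_succ, partials_cons]
    beta_reduce
    rw [hev.fderiv_eq,
      fderiv_continuousMultilinear_apply_const_apply hd]
    rfl

/-- The list of coordinates along which `multiDeriv α` differentiates. -/
def multiList (α : Fin N → ℕ) : List (Fin N) :=
  List.ofFn fun j : Fin (∑ i, α i) => (finSigmaFinEquiv.symm j).1

theorem count_ofFn {ι : Type*} [DecidableEq ι] {r : ℕ} (f : Fin r → ι) (a : ι) :
    (List.ofFn f).count a = ∑ j, if f j = a then 1 else 0 := by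
  induction r with
  | zero => simp
  | succ r ih =>
    rw [List.ofFn_succ, List.count_cons, ih, Fin.sum_univ_succ, add_comm]
    simp

theorem count_multiList (α : Fin N → ℕ) (i : Fin N) : (multiList α).count i = α i := by
  rw [multiList, count_ofFn,
    Equiv.sum_comp finSigmaFinEquiv.symm (fun p => if p.1 = i then 1 else 0),
    Fintype.sum_sigma]
  simp [Finset.sum_ite_eq', apply_ite Finset.card]

theorem multiDeriv_eq_partials (hΩ : IsOpen Ω) {g : Eu N → ℂ} (hg : ContDiffOn ℝ ∞ g Ω)
    {l : List (Fin N)} {α : Fin N → ℕ} (hl : ∀ i, l.count i = α i) {x : Eu N} (hx : x ∈ Ω) :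
    multiDeriv α g x = partials l g x := by
  rw [multiDeriv, iteratedFDeriv_apply_stdVec hΩ hg _ hx]
  exact partials_perm hΩ hg (List.perm_iff_count.2 fun i => (count_multiList α i).trans (hl i).symm)
    hx

theorem iteratedFDeriv_apply_stdVec_eq_multiDeriv (hΩ : IsOpen Ω) {g : Eu N → ℂ}
    (hg : ContDiffOn ℝ ∞ g Ω) {k : ℕ} (I : Fin k → Fin N) {x : Eu N} (hx : x ∈ Ω) :
    iteratedFDeriv ℝ k g x (fun j => stdVec (I j)) =
      multiDeriv (fun i => (List.ofFn I).count i) g x := by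
  rw [iteratedFDeriv_apply_stdVec hΩ hg I hx, multiDeriv_eq_partials hΩ hg (fun _ => rfl) hx]

theorem multiDeriv_fderiv_apply (hΩ : IsOpen Ω) {g : Eu N → ℂ} (hg : ContDiffOn ℝ ∞ g Ω)
    (α : Fin N → ℕ) (i : Fin N) {x : Eu N} (hx : x ∈ Ω) :
    multiDeriv α (fun y => fderiv ℝ g y (stdVec i)) x = multiDeriv (α + Pi.single i 1) g x := by
  rw [multiDeriv_eq_partials hΩ (contDiffOn_fderiv_apply hΩ hg _) (count_multiList α) hx,
    multiDeriv_eq_partials hΩ hg (l := multiList α ++ [i]) (fun j => ?_) hx, partials_append]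
  · rfl
  · rw [List.count_append, count_multiList, Pi.add_apply]
    simp only [List.count_singleton, Pi.single_apply, beq_iff_eq, eq_comm (a := i)]

end Partials

/-! ### Multilinear maps are bounded by their values on the standard basis -/

section Multilinear

variable {N k : ℕ} {F : Type*} [NormedAddCommGroup F] [NormedSpace ℝ F]

theorem sum_smul_stdVec (v : Eu N) : ∑ i, v i • stdVec i = v := by
  ext j
  simp [stdVec, Finset.sum_apply, Pi.single_apply]

theorem ContinuousMultilinearMap.norm_le_sum_stdVec
    (A : ContinuousMultilinearMap ℝ (fun _ : Fin k => Eu N) F) :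
    ‖A‖ ≤ ∑ I : Fin k → Fin N, ‖A fun j => stdVec (I j)‖ := by
  refine A.opNorm_le_bound (Finset.sum_nonneg fun _ _ => norm_nonneg _) fun v => ?_
  have h : A v = ∑ I : Fin k → Fin N, (∏ j, v j (I j)) • A fun j => stdVec (I j) := by
    conv_lhs => rw [← funext fun j => sum_smul_stdVec (v j)]
    rw [A.map_sum]
    exact Finset.sum_congr rfl fun I _ => A.map_smul_univ _ _
  rw [h, Finset.sum_mul]
  refine (norm_sum_le _ _).trans (Finset.sum_le_sum fun I _ => ?_)
  rw [norm_smul, mul_comm, norm_prod]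
  gcongr with j
  exact PiLp.norm_apply_le (v j) (I j)

theorem norm_le_sum_stdVec (w : (Eu N) [⋀^Fin k]→L[ℝ] F) :
    ‖w‖ ≤ ∑ I : Fin k → Fin N, ‖w fun j => stdVec (I j)‖ :=
  w.toContinuousMultilinearMap.norm_le_sum_stdVec

instance finiteDimensional_complexForms : FiniteDimensional ℂ ((Eu N) [⋀^Fin k]→L[ℝ] ℂ) := by
  let E : ((Eu N) [⋀^Fin k]→L[ℝ] ℂ) →ₗ[ℂ] (Fin k → Fin N) → ℂ :=
    { toFun := fun w I => w fun j => stdVec (I j)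
      map_add' := fun _ _ => rfl
      map_smul' := fun _ _ => rfl }
  refine FiniteDimensional.of_injective E ((injective_iff_map_eq_zero E).2 fun w hw => ?_)
  refine norm_le_zero_iff.1 ((norm_le_sum_stdVec w).trans_eq ?_)
  exact Finset.sum_eq_zero fun I _ => by rw [norm_eq_zero]; exact congrFun hw I

/-- The evaluation of forms at a `k`-tuple of basis vectors. -/
def evalStd (I : Fin k → Fin N) : ((Eu N) [⋀^Fin k]→L[ℝ] ℂ) →L[ℝ] ℂ :=
  ContinuousAlternatingMap.apply ℝ _ _ (fun j => stdVec (I j))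

/-- This passes from Gevrey norms, which see partial derivatives of coefficients, to the operator
norms of `iteratedFDeriv` used for series of smooth maps. -/
theorem norm_iteratedFDeriv_le_sum_multiDeriv {Ω : Set (Eu N)} (hΩ : IsOpen Ω) {f : DForm N k}
    (hf : ContDiffOn ℝ ∞ f Ω) (r : ℕ) {x : Eu N} (hx : x ∈ Ω) :
    ‖iteratedFDeriv ℝ r f x‖ ≤ ∑ J : Fin r → Fin N, ∑ I : Fin k → Fin N,
      ‖multiDeriv (fun i => (List.ofFn J).count i) (fun y => f y fun j => stdVec (I j)) x‖ := by
  refine (ContinuousMultilinearMap.norm_le_sum_stdVec _).trans (Finset.sum_le_sum fun J _ => ?_)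
  refine (norm_le_sum_stdVec _).trans (Finset.sum_le_sum fun I _ => le_of_eq ?_)
  have h1 : ContDiffOn ℝ ∞ (fun y => f y fun j => stdVec (I j)) Ω :=
    (evalStd I).contDiff.comp_contDiffOn hf
  rw [← iteratedFDeriv_apply_stdVec_eq_multiDeriv hΩ h1 J hx]
  have h2 := (evalStd I).iteratedFDeriv_comp_left (hf.contDiffAt (hΩ.mem_nhds hx))
    (i := r) (WithTop.coe_le_coe.2 le_top)
  exact congrArg norm (DFunLike.congr_fun h2 (fun j => stdVec (J j))).symm

end Multilinear

/-! ### Gevrey norms -/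

section Gevrey

variable {N k : ℕ}

/-- The weight `C^|α| (α!)^s`. -/
def gevreyWeight (s C : ℝ) (α : Fin N → ℕ) : ℝ :=
  C ^ (∑ i, α i) * ((∏ i, (α i).factorial : ℕ) : ℝ) ^ s

theorem prod_factorial_pos (α : Fin N → ℕ) : (0 : ℝ) < ((∏ i, (α i).factorial : ℕ) : ℝ) :=
  Nat.cast_pos.2 (Finset.prod_pos fun i _ => (α i).factorial_pos)

theorem gevreyWeight_pos (s : ℝ) {C : ℝ} (hC : 0 < C) (α : Fin N → ℕ) : 0 < gevreyWeight s C α :=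
  mul_pos (pow_pos hC _) (Real.rpow_pos_of_pos (prod_factorial_pos α) _)

theorem gevreyNorm_le_iff {s C B : ℝ} (hC : 0 < C) (hB : 0 ≤ B) {K : Set (Eu N)}
    {g : Eu N → ℂ} :
    gevreyNorm s C K g ≤ ENNReal.ofReal B ↔
      ∀ α, ∀ x ∈ K, ‖multiDeriv α g x‖ ≤ B * gevreyWeight s C α := by
  simp only [gevreyNorm, iSup_le_iff]
  refine forall_congr' fun α => forall₂_congr fun x _ => ?_
  rw [ENNReal.ofReal_le_ofReal_iff hB]
  have h : C⁻¹ ^ (∑ i, α i) * ((∏ i, (α i).factorial : ℕ) : ℝ) ^ (-s) =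
      (gevreyWeight s C α)⁻¹ := by
    rw [gevreyWeight, mul_inv, inv_pow, Real.rpow_neg (prod_factorial_pos α).le]
  rw [h, inv_mul_le_iff₀ (gevreyWeight_pos s hC α), mul_comm]

theorem formNorm_le_iff {s C B : ℝ} (hC : 0 < C) (hB : 0 ≤ B) {K : Set (Eu N)} {f : DForm N k} :
    formNorm s C K f ≤ ENNReal.ofReal B ↔
      ∀ (I : Fin k → Fin N) (α : Fin N → ℕ), ∀ x ∈ K,
        ‖multiDeriv α (fun y => f y fun j => stdVec (I j)) x‖ ≤ B * gevreyWeight s C α := by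
  simp only [formNorm, iSup_le_iff, gevreyNorm_le_iff hC hB]

theorem formNorm_mono {s C : ℝ} {K K' : Set (Eu N)} (h : K ⊆ K') (f : DForm N k) :
    formNorm s C K f ≤ formNorm s C K' f :=
  iSup_mono fun _ => iSup_mono fun _ => iSup_le fun x => iSup_le fun hx =>
    le_iSup₂_of_le x (h hx) le_rfl

theorem multiDeriv_eq_zero_of_notMem {g : Eu N → ℂ} {K : Set (Eu N)} (hK : IsClosed K)
    (hg : Function.support g ⊆ K) (α : Fin N → ℕ) {x : Eu N} (hx : x ∉ K) :
    multiDeriv α g x = 0 := by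
  have h : iteratedFDeriv ℝ (∑ i, α i) g x = 0 := by
    by_contra hne
    exact hx ((closure_minimal hg hK) (support_iteratedFDeriv_subset (𝕜 := ℝ) _ hne))
  rw [multiDeriv, h]; rfl

/-- The norm of a form on a closed set that contains its support is its norm on the whole space. -/
theorem formNorm_eq_univ_of_support_subset {s C : ℝ} {K : Set (Eu N)} (hK : IsClosed K)
    {f : DForm N k} (hf : Function.support f ⊆ K) :
    formNorm s C K f = formNorm s C Set.univ f := by
  refine le_antisymm (formNorm_mono (Set.subset_univ K) f) ?_
  refine iSup_mono fun I => iSup_mono fun α => iSup₂_le fun x _ => ?_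
  by_cases hx : x ∈ K
  · exact le_iSup₂_of_le x hx le_rfl
  · rw [multiDeriv_eq_zero_of_notMem hK _ α hx]
    · simp
    · intro y hy
      refine hf fun h0 => hy ?_
      simp [h0]

theorem formNorm_eq_ofReal_toReal {s C : ℝ} {K : Set (Eu N)} {f : DForm N k}
    (h : formNorm s C K f < ⊤) :
    formNorm s C K f = ENNReal.ofReal (formNorm s C K f).toReal :=
  (ENNReal.ofReal_toReal h.ne).symm

theorem formNorm_const_smul_le {s C B : ℝ} (hC : 0 < C) (hB : 0 ≤ B) {Ω K : Set (Eu N)}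
    (hΩ : IsOpen Ω) (hK : K ⊆ Ω) {f : DForm N k} (hf : ContDiffOn ℝ ∞ f Ω)
    (h : formNorm s C K f ≤ ENNReal.ofReal B) {c : ℝ} (hc : 0 ≤ c) :
    formNorm s C K (c • f) ≤ ENNReal.ofReal (c * B) := by
  rw [formNorm_le_iff hC hB] at h
  rw [formNorm_le_iff hC (mul_nonneg hc hB)]
  intro I α x hx
  have h1 : ContDiffAt ℝ ∞ (fun y => f y fun j => stdVec (I j)) x :=
    ((evalStd I).contDiff.comp_contDiffOn hf).contDiffAt (hΩ.mem_nhds (hK hx))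
  have h2 : multiDeriv α (fun y => (c • f) y fun j => stdVec (I j)) x =
      c • multiDeriv α (fun y => f y fun j => stdVec (I j)) x :=
    DFunLike.congr_fun (iteratedFDeriv_const_smul_apply (a := c) (i := ∑ i, α i)
      (h1.of_le (WithTop.coe_le_coe.2 le_top))) _
  rw [h2, norm_smul, Real.norm_of_nonneg hc, mul_assoc]
  exact mul_le_mul_of_nonneg_left (h I α x hx) hc

theorem gevreyWeight_add_single (s C : ℝ) (α : Fin N → ℕ) (i : Fin N) :
    gevreyWeight s C (α + Pi.single i 1) =
      C * ((α i : ℝ) + 1) ^ s * gevreyWeight s C α := by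
  have h1 : ∑ j, (α + Pi.single i 1 : Fin N → ℕ) j = ∑ j, α j + 1 := by
    simp [Finset.sum_add_distrib]
  have h2 : ∏ j, ((α + Pi.single i 1 : Fin N → ℕ) j).factorial = (α i + 1) * ∏ j, (α j).factorial := by
    rw [← Finset.mul_prod_erase _ _ (Finset.mem_univ i), ← Finset.mul_prod_erase Finset.univ
      (fun j => (α j).factorial) (Finset.mem_univ i), ← mul_assoc]
    congr 1
    · simp [Nat.factorial_succ]
    · refine Finset.prod_congr rfl fun j hj => ?_
      simp [Pi.single_eq_of_ne (Finset.ne_of_mem_erase hj)]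
  rw [gevreyWeight, gevreyWeight, h1, h2, Nat.cast_mul,
    Real.mul_rpow (Nat.cast_nonneg _) (Nat.cast_nonneg _), pow_succ]
  push_cast
  ring

/-- An increase of the constant absorbs the loss of one derivative. -/
theorem exists_gevreyWeight_add_single_le {s C C' : ℝ} (hs : 0 ≤ s) (hC : 0 < C) (hCC' : C < C') :
    ∃ A : ℝ, 0 ≤ A ∧ ∀ (α : Fin N → ℕ) (i : Fin N),
      gevreyWeight s C (α + Pi.single i 1) ≤ A * gevreyWeight s C' α := by
  have hC' : 0 < C' := hC.trans hCC'
  set r := C / C' with hr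
  have hr0 : 0 < r := div_pos hC hC'
  have hr1 : r < 1 := (div_lt_one hC').2 hCC'
  obtain ⟨A, hA⟩ := (tendsto_pow_const_mul_const_pow_of_abs_lt_one ⌈s⌉₊
    (by rwa [abs_of_pos hr0])).bddAbove_range
  -- `A` bounds `n ^ ⌈s⌉₊ * r ^ n`. Its use at `n = p + 1` leaves one surplus factor `r`, hence the
  -- `r⁻¹`.
  have hA' : ∀ p : ℕ, ((p : ℝ) + 1) ^ s * C ^ p ≤ A * r⁻¹ * C' ^ p := by
    intro p
    have h1 : ((p : ℝ) + 1) ^ ⌈s⌉₊ * r ^ (p + 1) ≤ A := by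
      simpa using hA (Set.mem_range_self (p + 1))
    have h2 : ((p : ℝ) + 1) ^ s ≤ ((p : ℝ) + 1) ^ ⌈s⌉₊ := by
      rw [← Real.rpow_natCast]
      exact Real.rpow_le_rpow_of_exponent_le (by linarith [p.cast_nonneg (α := ℝ)]) (Nat.le_ceil s)
    have h3 : C ^ p = r ^ p * C' ^ p := by rw [hr, div_pow, div_mul_cancel₀ _ (by positivity)]
    rw [h3, ← mul_assoc]
    refine mul_le_mul_of_nonneg_right ?_ (pow_pos hC' p).le
    rw [← div_eq_mul_inv, le_div_iff₀ hr0, mul_assoc, ← pow_succ]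
    exact (mul_le_mul_of_nonneg_right h2 (by positivity)).trans h1
  have hA0 : 0 ≤ A := le_trans (by positivity) (hA (Set.mem_range_self 0))
  refine ⟨C * (A * r⁻¹), by positivity, fun α i => ?_⟩
  rw [gevreyWeight_add_single, gevreyWeight, gevreyWeight]
  have h4 : ((α i : ℝ) + 1) ^ s ≤ ((∑ j, α j : ℕ) + 1 : ℝ) ^ s := by
    gcongr
    exact Finset.single_le_sum (f := α) (fun _ _ => Nat.zero_le _) (Finset.mem_univ i)
  have h5 := (mul_le_mul_of_nonneg_right h4 (pow_pos hC (∑ j, α j)).le).trans (hA' (∑ j, α j))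
  have h6 := (Real.rpow_pos_of_pos (prod_factorial_pos α) s).le
  calc _ = C * (((α i : ℝ) + 1) ^ s * C ^ (∑ j, α j)) *
        ((∏ i, (α i).factorial : ℕ) : ℝ) ^ s := by ring
    _ ≤ C * (A * r⁻¹ * C' ^ (∑ j, α j)) * ((∏ i, (α i).factorial : ℕ) : ℝ) ^ s := by gcongr
    _ = _ := by ring

/-- Each coefficient of `dv` is a signed sum of `k + 1` first partial derivatives of coefficients of
`v`, and the larger constant absorbs the extra derivative. -/
theorem formNorm_extDeriv_lt_top {s C C' : ℝ} (hs : 0 ≤ s) (hC : 0 < C) (hCC' : C < C')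
    {K : Set (Eu N)} {v : DForm N k} (hv : ContDiff ℝ ∞ v) (h : formNorm s C K v < ⊤) :
    formNorm s C' K (extDeriv v) < ⊤ := by
  obtain ⟨A, hA0, hA⟩ := exists_gevreyWeight_add_single_le (N := N) hs hC hCC'
  set B := (formNorm s C K v).toReal
  have hB0 : 0 ≤ B := ENNReal.toReal_nonneg
  have hB := (formNorm_le_iff hC hB0).1 (formNorm_eq_ofReal_toReal h).le
  refine lt_of_le_of_lt ((formNorm_le_iff (hC.trans hCC')
    (B := ∑ _i : Fin (k + 1), B * A) (by positivity)).2 fun I α x hx => ?_) ENNReal.ofReal_lt_top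
  have hcomp : ∀ J : Fin k → Fin N, ContDiff ℝ ∞ (fun y => v y fun j => stdVec (J j)) :=
    fun J => (evalStd J).contDiff.comp hv
  let g : Fin (k + 1) → Eu N → ℂ := fun i y =>
    fderiv ℝ (fun z => v z fun j => stdVec (I (i.succAbove j))) y (stdVec (I i))
  have hg : ∀ i, ContDiff ℝ ∞ (g i) := fun i =>
    contDiffOn_univ.1 (contDiffOn_fderiv_apply isOpen_univ (hcomp _).contDiffOn _)
  have hgs : ∀ i : Fin (k + 1), ContDiff ℝ ∞ (((-1 : ℝ) ^ (i : ℕ)) • g i) := fun i => (hg i).const_smul ((-1 : ℝ) ^ (i : ℕ))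
  have h1 : (fun y => extDeriv v y fun j => stdVec (I j)) =
      fun y => ∑ i : Fin (k + 1), (((-1 : ℝ) ^ (i : ℕ)) • g i) y := by
    funext y
    rw [extDeriv_apply (hv.differentiable (by simp) y)]
    refine Finset.sum_congr rfl fun i _ => ?_
    rw [Pi.smul_apply, zsmul_eq_mul, Complex.real_smul]
    push_cast
    rfl
  have h2 : multiDeriv α (fun y => extDeriv v y fun j => stdVec (I j)) x =
      ∑ i : Fin (k + 1), ((-1 : ℝ) ^ (i : ℕ)) • multiDeriv α (g i) x := by
    rw [h1, multiDeriv, iteratedFDeriv_sum fun i _ => (hgs i).of_le (WithTop.coe_le_coe.2 le_top)]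
    simp only [Finset.sum_apply, _root_.sum_apply]
    refine Finset.sum_congr rfl fun i _ => ?_
    rw [iteratedFDeriv_const_smul_apply ((hg i).contDiffAt.of_le (WithTop.coe_le_coe.2 le_top))]
    rfl
  rw [h2, Finset.sum_mul]
  refine (norm_sum_le _ _).trans (Finset.sum_le_sum fun i _ => ?_)
  rw [norm_smul, norm_pow, norm_neg, norm_one, one_pow, one_mul,
    multiDeriv_fderiv_apply isOpen_univ (hcomp _).contDiffOn α (I i) (Set.mem_univ x), mul_assoc]
  exact (hB _ _ x hx).trans (mul_le_mul_of_nonneg_left (hA α (I i)) hB0)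

theorem support_extDeriv_subset {v : DForm N k} {K : Set (Eu N)} (hK : IsClosed K)
    (hv : Function.support v ⊆ K) : Function.support (extDeriv v) ⊆ K := by
  intro x hx
  by_contra hxK
  refine hx ?_
  have : v =ᶠ[nhds x] fun _ => 0 := by
    filter_upwards [hK.isOpen_compl.mem_nhds hxK] with y hy
    exact Function.notMem_support.1 fun h => hy (hv h)
  rw [this.extDeriv_eq, extDeriv]
  ext
  simp [ContinuousAlternatingMap.alternatizeUncurryFin_apply]

end Gevrey

/-! ### Series of smooth functions on an open set -/

section Series

variable {E F : Type*} [NormedAddCommGroup E] [NormedSpace ℝ E] [ProperSpace E]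
  [NormedAddCommGroup F] [NormedSpace ℝ F] [CompleteSpace F] {Ω : Set E} {g : ℕ → E → F}

/-- Termwise differentiation requires a connected open set with uniform bounds. A ball whose closure
lies in `Ω` provides both. -/
theorem hasFDerivAt_iteratedFDeriv_tsum (hΩ : IsOpen Ω) (hg : ∀ j, ContDiffOn ℝ ∞ (g j) Ω)
    (hb : ∀ r : ℕ, ∀ K ⊆ Ω, IsCompact K → ∃ u : ℕ → ℝ, Summable u ∧
      ∀ j, ∀ x ∈ K, ‖iteratedFDeriv ℝ r (g j) x‖ ≤ u j) (r : ℕ) {x : E} (hx : x ∈ Ω) :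
    HasFDerivAt (fun y => ∑' j, iteratedFDeriv ℝ r (g j) y)
      (∑' j, iteratedFDeriv ℝ (r + 1) (g j) x).curryLeft x := by
  obtain ⟨δ, hδ, hball⟩ := Metric.nhds_basis_closedBall.mem_iff.1 (hΩ.mem_nhds hx)
  obtain ⟨u, hu, hub⟩ := hb (r + 1) _ hball (isCompact_closedBall x δ)
  obtain ⟨w, hw, hwb⟩ := hb r _ hball (isCompact_closedBall x δ)
  have hd : ∀ j, ∀ y ∈ Metric.ball x δ, HasFDerivAt (iteratedFDeriv ℝ r (g j))
      (iteratedFDeriv ℝ (r + 1) (g j) y).curryLeft y := by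
    intro j y hy
    have h := ((hg j).contDiffAt (hΩ.mem_nhds (hball (Metric.ball_subset_closedBall hy)))
      ).differentiableAt_iteratedFDeriv (m := r)
        (WithTop.coe_lt_coe.2 (WithTop.coe_lt_top r))
    refine h.hasFDerivAt.congr_fderiv ?_
    rw [fderiv_iteratedFDeriv]
    rfl
  have h := hasFDerivAt_tsum_of_isPreconnected hu Metric.isOpen_ball
    (convex_ball x δ).isPreconnected hd
    (fun j y hy => by
      rw [ContinuousMultilinearMap.curryLeft_norm]
      exact hub j y (Metric.ball_subset_closedBall hy))
    (Metric.mem_ball_self hδ)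
    (Summable.of_norm_bounded hw fun j => hwb j x (Metric.mem_closedBall_self hδ.le))
    (Metric.mem_ball_self hδ)
  refine h.congr_fderiv (Eq.symm ?_)
  exact (continuousMultilinearCurryLeftEquiv ℝ (fun _ : Fin (r + 1) => E) F
    ).toContinuousLinearEquiv.toContinuousLinearMap.map_tsum
    (Summable.of_norm_bounded hu fun j => hub j x (Metric.mem_closedBall_self hδ.le))

theorem hasFTaylorSeriesUpToOn_tsum (hΩ : IsOpen Ω) (hg : ∀ j, ContDiffOn ℝ ∞ (g j) Ω)
    (hb : ∀ r : ℕ, ∀ K ⊆ Ω, IsCompact K → ∃ u : ℕ → ℝ, Summable u ∧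
      ∀ j, ∀ x ∈ K, ‖iteratedFDeriv ℝ r (g j) x‖ ≤ u j) :
    HasFTaylorSeriesUpToOn ∞ (fun x => ∑' j, g j x)
      (fun x r => ∑' j, iteratedFDeriv ℝ r (g j) x) Ω where
  zero_eq x hx := by
    obtain ⟨u, hu, hub⟩ := hb 0 {x} (Set.singleton_subset_iff.2 hx) isCompact_singleton
    exact ((continuousMultilinearCurryFin0 ℝ E F
      ).toContinuousLinearEquiv.toContinuousLinearMap.map_tsum
      (Summable.of_norm_bounded hu fun j => hub j x rfl)).trans
      (tsum_congr fun j => by simp)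
  fderivWithin r _ x hx := (hasFDerivAt_iteratedFDeriv_tsum hΩ hg hb r hx).hasFDerivWithinAt
  cont r _ x hx :=
    (hasFDerivAt_iteratedFDeriv_tsum hΩ hg hb r hx).continuousAt.continuousWithinAt

theorem contDiffOn_tsum (hΩ : IsOpen Ω) (hg : ∀ j, ContDiffOn ℝ ∞ (g j) Ω)
    (hb : ∀ r : ℕ, ∀ K ⊆ Ω, IsCompact K → ∃ u : ℕ → ℝ, Summable u ∧
      ∀ j, ∀ x ∈ K, ‖iteratedFDeriv ℝ r (g j) x‖ ≤ u j) :
    ContDiffOn ℝ ∞ (fun x => ∑' j, g j x) Ω :=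
  (hasFTaylorSeriesUpToOn_tsum hΩ hg hb).contDiffOn

theorem iteratedFDeriv_tsum_of_isOpen (hΩ : IsOpen Ω) (hg : ∀ j, ContDiffOn ℝ ∞ (g j) Ω)
    (hb : ∀ r : ℕ, ∀ K ⊆ Ω, IsCompact K → ∃ u : ℕ → ℝ, Summable u ∧
      ∀ j, ∀ x ∈ K, ‖iteratedFDeriv ℝ r (g j) x‖ ≤ u j) (r : ℕ) {x : E} (hx : x ∈ Ω) :
    iteratedFDeriv ℝ r (fun x => ∑' j, g j x) x = ∑' j, iteratedFDeriv ℝ r (g j) x := by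
  rw [← iteratedFDerivWithin_of_isOpen r hΩ hx]
  exact ((hasFTaylorSeriesUpToOn_tsum hΩ hg hb).eq_iteratedFDerivWithin_of_uniqueDiffOn
    (WithTop.coe_le_coe.2 le_top) hΩ.uniqueDiffOn hx).symm

theorem hasSum_fderiv_of_isOpen (hΩ : IsOpen Ω) (hg : ∀ j, ContDiffOn ℝ ∞ (g j) Ω)
    (hb : ∀ r : ℕ, ∀ K ⊆ Ω, IsCompact K → ∃ u : ℕ → ℝ, Summable u ∧
      ∀ j, ∀ x ∈ K, ‖iteratedFDeriv ℝ r (g j) x‖ ≤ u j) {x : E} (hx : x ∈ Ω) :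
    HasSum (fun j => fderiv ℝ (g j) x) (fderiv ℝ (fun x => ∑' j, g j x) x) := by
  obtain ⟨u, hu, hub⟩ := hb 1 {x} (Set.singleton_subset_iff.2 hx) isCompact_singleton
  have h1 : HasSum (fun j => iteratedFDeriv ℝ 1 (g j) x)
      (iteratedFDeriv ℝ 1 (fun x => ∑' j, g j x) x) := by
    rw [iteratedFDeriv_tsum_of_isOpen hΩ hg hb 1 hx]
    exact (Summable.of_norm_bounded hu fun j => hub j x rfl).hasSum
  have hA : ∀ f : E → F, fderiv ℝ f x =
      continuousMultilinearCurryFin1 ℝ E F (iteratedFDeriv ℝ 1 f x) := by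
    intro f
    ext e
    simp [iteratedFDeriv_one_apply]
  simp only [hA]
  exact h1.mapL (continuousMultilinearCurryFin1 ℝ E F
    ).toContinuousLinearEquiv.toContinuousLinearMap

end Series

/-! ### Absolutely convergent series of Gevrey cocycles -/

section FormSeries

variable {N q : ℕ} {s C : ℝ} {Ω : Set (Eu N)} {f : ℕ → DForm N q} {a : ℕ → ℝ}

/-- A bound for the derivatives of order `r` of forms whose norm is at most `1`. -/
def derivBound (N q : ℕ) (s C : ℝ) (r : ℕ) : ℝ :=
  ∑ J : Fin r → Fin N, ∑ _I : Fin q → Fin N, gevreyWeight s C fun i => (List.ofFn J).count i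

theorem norm_iteratedFDeriv_le_of_formNorm_le (hC : 0 < C) (hΩ : IsOpen Ω) {K : Set (Eu N)}
    (hK : K ⊆ Ω) {f : DForm N q} (hf : ContDiffOn ℝ ∞ f Ω) {B : ℝ} (hB : 0 ≤ B)
    (h : formNorm s C K f ≤ ENNReal.ofReal B) (r : ℕ) {x : Eu N} (hx : x ∈ K) :
    ‖iteratedFDeriv ℝ r f x‖ ≤ B * derivBound N q s C r := by
  refine (norm_iteratedFDeriv_le_sum_multiDeriv hΩ hf r (hK hx)).trans ?_
  rw [derivBound, Finset.mul_sum]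
  refine Finset.sum_le_sum fun J _ => ?_
  rw [Finset.mul_sum]
  exact Finset.sum_le_sum fun I _ => (formNorm_le_iff hC hB).1 h I _ x hx

theorem exists_summable_bound (hC : 0 < C) (hΩ : IsOpen Ω) (hf : ∀ j, ContDiffOn ℝ ∞ (f j) Ω)
    (hb : ∀ K ⊆ Ω, IsCompact K → ∃ B : ℝ, 0 ≤ B ∧ ∀ j, formNorm s C K (f j) ≤ ENNReal.ofReal B)
    (ha : Summable fun j => |a j|) (r : ℕ) (K : Set (Eu N)) (hK : K ⊆ Ω) (hKc : IsCompact K) :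
    ∃ u : ℕ → ℝ, Summable u ∧ ∀ j, ∀ x ∈ K, ‖iteratedFDeriv ℝ r (a j • f j) x‖ ≤ u j := by
  obtain ⟨B, hB0, hB⟩ := hb K hK hKc
  refine ⟨fun j => |a j| * (B * derivBound N q s C r), ha.mul_right _, fun j x hx => ?_⟩
  rw [iteratedFDeriv_const_smul_apply (((hf j).contDiffAt (hΩ.mem_nhds (hK hx))).of_le
    (WithTop.coe_le_coe.2 le_top)), norm_smul, Real.norm_eq_abs]
  exact mul_le_mul_of_nonneg_left
    (norm_iteratedFDeriv_le_of_formNorm_le hC hΩ hK (hf j) hB0 (hB j) r hx) (abs_nonneg _)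

/-- On each compact set the sum has norm at most `∑ |a_j| B` with the same constant `C`, since every
derivative may be taken term by term. -/
theorem isGevreyFormSome_tsum (hC : 0 < C) (hΩ : IsOpen Ω) (hf : ∀ j, ContDiffOn ℝ ∞ (f j) Ω)
    (hb : ∀ K ⊆ Ω, IsCompact K → ∃ B : ℝ, 0 ≤ B ∧ ∀ j, formNorm s C K (f j) ≤ ENNReal.ofReal B)
    (ha : Summable fun j => |a j|) :
    IsGevreyFormSome s Ω (fun x => ∑' j, (a j • f j) x) := by
  have hg : ∀ j, ContDiffOn ℝ ∞ (a j • f j) Ω := fun j => (hf j).const_smul (a j)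
  have hbd := exists_summable_bound hC hΩ hf hb ha
  have hF := contDiffOn_tsum hΩ hg hbd
  refine ⟨hF, fun K hK hKc => ⟨C, hC, ?_⟩⟩
  obtain ⟨B, hB0, hB⟩ := hb K hK hKc
  refine lt_of_le_of_lt ((formNorm_le_iff hC (B := ∑' j, |a j| * B)
    (tsum_nonneg fun j => by positivity)).2 fun I α x hx => ?_) ENNReal.ofReal_lt_top
  have hle : ((∑ i, α i : ℕ) : ℕ∞ω) ≤ ∞ := WithTop.coe_le_coe.2 le_top
  have hxΩ := hΩ.mem_nhds (hK hx)
  have hcomp : ∀ h : DForm N q, ContDiffOn ℝ ∞ h Ω →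
      multiDeriv α (fun y => h y fun j => stdVec (I j)) x =
        evalStd I (iteratedFDeriv ℝ (∑ i, α i) h x
          fun j => stdVec (finSigmaFinEquiv.symm j).1) := fun h hh =>
    DFunLike.congr_fun ((evalStd I).iteratedFDeriv_comp_left (hh.contDiffAt hxΩ) hle) _
  obtain ⟨u, hu, hub⟩ := hbd (∑ i, α i) {x} (Set.singleton_subset_iff.2 (hK hx)) isCompact_singleton
  have hsum : HasSum (fun j => multiDeriv α (fun y => (a j • f j) y fun j => stdVec (I j)) x)
      (multiDeriv α (fun y => (∑' j, (a j • f j) y) fun j => stdVec (I j)) x) := by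
    rw [hcomp _ hF]
    simp only [fun j => hcomp _ (hg j)]
    have h1 : HasSum (fun j => iteratedFDeriv ℝ (∑ i, α i) (a j • f j) x)
        (iteratedFDeriv ℝ (∑ i, α i) (fun x => ∑' j, (a j • f j) x) x) := by
      rw [iteratedFDeriv_tsum_of_isOpen hΩ hg hbd _ (hK hx)]
      exact (Summable.of_norm_bounded hu fun j => hub j x rfl).hasSum
    exact (h1.mapL (ContinuousMultilinearMap.apply ℝ (fun _ : Fin (∑ i, α i) => Eu N) _
      fun j => stdVec (finSigmaFinEquiv.symm j).1)).mapL (evalStd I)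
  have hterm : ∀ j, ‖multiDeriv α (fun y => (a j • f j) y fun j => stdVec (I j)) x‖ ≤
      |a j| * B * gevreyWeight s C α := by
    intro j
    have h2 : multiDeriv α (fun y => (a j • f j) y fun j => stdVec (I j)) x =
        a j • multiDeriv α (fun y => f j y fun j => stdVec (I j)) x := by
      rw [hcomp _ (hg j), hcomp _ (hf j), iteratedFDeriv_const_smul_apply
        (((hf j).contDiffAt hxΩ).of_le hle), _root_.smul_apply, map_smul]
    rw [h2, norm_smul, Real.norm_eq_abs, mul_assoc]
    exact mul_le_mul_of_nonneg_left ((formNorm_le_iff hC hB0).1 (hB j) I α x hx) (abs_nonneg _)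
  rw [← hsum.tsum_eq, ← tsum_mul_right]
  exact tsum_of_norm_bounded ((ha.mul_right B).mul_right _).hasSum hterm

/-- At each point `d` of the sum is the limit of `d` of the partial sums, and the ideal is closed
because it is finite-dimensional. -/
theorem isCocycle_tsum {T : Eu N → Submodule ℂ (Eu N →L[ℝ] ℂ)} (hC : 0 < C) (hΩ : IsOpen Ω)
    (hf : ∀ j, ContDiffOn ℝ ∞ (f j) Ω)
    (hb : ∀ K ⊆ Ω, IsCompact K → ∃ B : ℝ, 0 ≤ B ∧ ∀ j, formNorm s C K (f j) ≤ ENNReal.ofReal B)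
    (ha : Summable fun j => |a j|) (hcoc : ∀ j, IsCocycle T Ω (f j)) :
    IsCocycle T Ω (fun x => ∑' j, (a j • f j) x) := by
  intro x hx
  let A : (Eu N →L[ℝ] (Eu N) [⋀^Fin q]→L[ℝ] ℂ) →L[ℝ] (Eu N) [⋀^Fin (q + 1)]→L[ℝ] ℂ :=
    ContinuousAlternatingMap.alternatizeUncurryFinCLM ℝ (Eu N) ℂ
  have h := (hasSum_fderiv_of_isOpen hΩ (fun j => (hf j).const_smul (a j))
    (exists_summable_bound hC hΩ hf hb ha) hx).mapL A
  refine (Submodule.closed_of_finiteDimensional (idealPart (T x) 1 (q + 1))).mem_of_tendsto h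
    (Filter.Eventually.of_forall fun t => Submodule.sum_mem _ fun j _ => ?_)
  change extDeriv (a j • f j) x ∈ _
  rw [extDeriv_smul]
  exact Submodule.smul_of_tower_mem _ (a j) (hcoc j x hx)

end FormSeries

/-! ### A uniform boundedness principle for series with coefficients in `ℓ¹` -/

section UniformBoundedness

theorem summable_abs_of_lp_one (a : lp (fun _ : ℕ => ℝ) 1) : Summable fun i => |a i| := by
  simpa using (memℓp_gen_iff (p := 1) (by simp)).1 (lp.memℓp a)

/-- The functional `a ↦ ∑ aᵢ cᵢ` on `ℓ¹` for a bounded sequence `c`. -/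
def seriesCLM (c : ℕ → ℂ) (B : ℝ) (hc : ∀ i, ‖c i‖ ≤ B) : lp (fun _ : ℕ => ℝ) 1 →L[ℝ] ℂ :=
  have hs : ∀ a : lp (fun _ : ℕ => ℝ) 1, Summable fun i => a i • c i := fun a =>
    Summable.of_norm_bounded ((summable_abs_of_lp_one a).mul_right B) fun i => by
      rw [norm_smul, Real.norm_eq_abs]
      exact mul_le_mul_of_nonneg_left (hc i) (abs_nonneg _)
  LinearMap.mkContinuous
    { toFun := fun a => ∑' i, a i • c i
      map_add' := fun a b => by
        rw [← (hs a).tsum_add (hs b)]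
        exact tsum_congr fun i => add_smul _ _ _
      map_smul' := fun r a => by
        rw [RingHom.id_apply, ← (hs a).tsum_const_smul]
        exact tsum_congr fun i => by simp [mul_assoc] } B
    (fun a => by
      have h : HasSum (fun i => |a i|) ‖a‖ := by
        simpa using lp.hasSum_norm (p := 1) (by simp) a
      rw [mul_comm]
      refine tsum_of_norm_bounded (h.mul_right B) fun i => ?_
      rw [norm_smul, Real.norm_eq_abs]
      exact mul_le_mul_of_nonneg_left (hc i) (abs_nonneg _))

/-- If the functionals `a ↦ ∑ aᵢ c(v)ᵢ` on `ℓ¹` are controlled by `R`, for each `a` on some member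
of a sequence of families, then their coefficients are uniformly controlled on one of them. -/
theorem exists_uniform_bound_of_pointwise_bound {X : Type*} (𝒱 : ℕ → Set X) (R : X → ℝ)
    (c : X → ℕ → ℂ) (hc : ∀ j, ∀ v ∈ 𝒱 j, ∃ B : ℝ, ∀ i, ‖c v i‖ ≤ B)
    (h : ∀ a : lp (fun _ : ℕ => ℝ) 1, ∃ j : ℕ, ∀ v ∈ 𝒱 j, ‖∑' i, a i • c v i‖ ≤ j * R v) :
    ∃ (j : ℕ) (B : ℝ), ∀ v ∈ 𝒱 j, ∀ i, ‖c v i‖ ≤ B * R v := by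
  let A : ℕ → Set (lp (fun _ : ℕ => ℝ) 1) := fun j =>
    {a | ∀ v ∈ 𝒱 j, ‖∑' i, a i • c v i‖ ≤ j * R v}
  have hclosed : ∀ j, IsClosed (A j) := by
    intro j
    simp only [A, Set.ofPred_forall]
    refine isClosed_iInter fun v => isClosed_iInter fun hv => ?_
    obtain ⟨B, hB⟩ := hc j v hv
    exact isClosed_le (seriesCLM (c v) B hB).continuous.norm continuous_const
  -- The sets `A j` are closed and cover the complete space `ℓ¹`, so Baire's theorem provides one
  -- with an interior point.
  obtain ⟨j, a₀, ha₀⟩ := nonempty_interior_of_iUnion_of_closed hclosed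
    (Set.eq_univ_of_forall fun a => Set.mem_iUnion.2 (h a))
  obtain ⟨δ, hδ, hball⟩ := Metric.nhds_basis_closedBall.mem_iff.1 (mem_interior_iff_mem_nhds.1 ha₀)
  refine ⟨j, j / δ, fun v hv i => ?_⟩
  obtain ⟨B, hB⟩ := hc j v hv
  let L := seriesCLM (c v) B hB
  -- Both `a₀ + e` and `a₀ - e` lie in the ball inside `A j`. Their difference isolates `δ • c v i`
  -- and yields the constant `j / δ`.
  let e : lp (fun _ : ℕ => ℝ) 1 := lp.single 1 i δ
  have he : ‖e‖ = δ := by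
    rw [lp.norm_single (by simp), Real.norm_of_nonneg hδ.le]
  have hLe : L e = δ • c v i := by
    change ∑' k, e k • c v k = _
    rw [tsum_eq_single i]
    · simp [e]
    · intro k hk
      simp [e, hk]
  have h1 : ‖L (a₀ + e)‖ ≤ j * R v := hball (by simp [he]) v hv
  have h2 : ‖L (a₀ - e)‖ ≤ j * R v := hball (by simp [he]) v hv
  have h3 : (2 : ℝ) • L e = L (a₀ + e) - L (a₀ - e) := by
    rw [map_add, map_sub, two_smul]; abel
  have h4 : 2 * (δ * ‖c v i‖) ≤ j * R v + j * R v := by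
    calc 2 * (δ * ‖c v i‖) = ‖(2 : ℝ) • L e‖ := by
          rw [hLe, norm_smul, norm_smul, Real.norm_of_nonneg hδ.le]; simp
      _ ≤ _ := by rw [h3]; exact (norm_sub_le _ _).trans (add_le_add h1 h2)
  rw [div_mul_eq_mul_div, le_div_iff₀ hδ]
  linarith

end UniformBoundedness

/-! ### The pairing of forms of complementary degrees -/

section TopWedge

variable {N q k : ℕ}

instance finiteDimensional_real_complexForms : FiniteDimensional ℝ ((Eu N) [⋀^Fin k]→L[ℝ] ℂ) :=
  Module.Finite.trans ℂ _

/-- The pairing `topWedge` as a bilinear map. -/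
def topWedgeₗ (h : q + k = N) : ((Eu N) [⋀^Fin q]→L[ℝ] ℂ) →ₗ[ℝ] ((Eu N) [⋀^Fin k]→L[ℝ] ℂ) →ₗ[ℝ] ℂ :=
  LinearMap.mk₂ ℝ (topWedge h)
    (fun a a' b => by
      simp only [topWedge, ← AlternatingMap.domCoprod'_apply, map_add,
        ContinuousAlternatingMap.toAlternatingMap_add, TensorProduct.add_tmul,
        AlternatingMap.add_apply])
    (fun c a b => by
      simp only [topWedge, ← AlternatingMap.domCoprod'_apply,
        ContinuousAlternatingMap.toAlternatingMap_smul, ← TensorProduct.smul_tmul', map_smul,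
        AlternatingMap.smul_apply])
    (fun a b b' => by
      simp only [topWedge, ← AlternatingMap.domCoprod'_apply, map_add,
        ContinuousAlternatingMap.toAlternatingMap_add, TensorProduct.tmul_add,
        AlternatingMap.add_apply])
    (fun c a b => by
      simp only [topWedge, ← AlternatingMap.domCoprod'_apply,
        ContinuousAlternatingMap.toAlternatingMap_smul, TensorProduct.tmul_smul, map_smul,
        AlternatingMap.smul_apply])

/-- The pairing `topWedge` as a continuous bilinear map. -/
def topWedgeL (h : q + k = N) : ((Eu N) [⋀^Fin q]→L[ℝ] ℂ) →L[ℝ] ((Eu N) [⋀^Fin k]→L[ℝ] ℂ) →L[ℝ] ℂ :=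
  LinearMap.toContinuousLinearMap (E := (Eu N) [⋀^Fin q]→L[ℝ] ℂ)
    (F' := ((Eu N) [⋀^Fin k]→L[ℝ] ℂ) →L[ℝ] ℂ)
    (LinearMap.comp (LinearEquiv.toLinearMap
      (LinearMap.toContinuousLinearMap (E := (Eu N) [⋀^Fin k]→L[ℝ] ℂ) (F' := ℂ))) (topWedgeₗ h))

theorem topWedgeL_apply (h : q + k = N) (a : (Eu N) [⋀^Fin q]→L[ℝ] ℂ)
    (b : (Eu N) [⋀^Fin k]→L[ℝ] ℂ) : topWedgeL h a b = topWedge h a b := rfl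

variable {Ω Q : Set (Eu N)}

theorem integrable_topWedge (h : q + k = N) (hQ : IsCompact Q) (hQΩ : Q ⊆ Ω) {f : DForm N q}
    (hf : ContinuousOn f Ω) {v : DForm N k} (hv : Continuous v) (hsupp : Function.support v ⊆ Q) :
    MeasureTheory.Integrable (fun x => topWedge h (f x) (v x)) := by
  have h1 : ContinuousOn (fun x => topWedge h (f x) (v x)) Q :=
    ((topWedgeL h).continuous.comp_continuousOn (hf.mono hQΩ)).clm_apply hv.continuousOn
  refine (MeasureTheory.integrableOn_iff_integrable_of_support_subset fun x hx => hsupp ?_).1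
    (h1.integrableOn_compact hQ)
  intro h0
  exact hx (by simp only [← topWedgeL_apply, h0, map_zero])

theorem setIntegral_topWedge (h : q + k = N) (hQΩ : Q ⊆ Ω) (f : DForm N q) {v : DForm N k}
    (hsupp : Function.support v ⊆ Q) :
    ∫ x in Ω, topWedge h (f x) (v x) = ∫ x, topWedge h (f x) (v x) := by
  refine MeasureTheory.setIntegral_eq_integral_of_forall_compl_eq_zero fun x hx => ?_
  have h0 : v x = 0 := Function.notMem_support.1 fun hxs => hx (hQΩ (hsupp hxs))
  rw [h0, ← topWedgeL_apply, map_zero]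

variable {f : ℕ → DForm N q} {v : DForm N k}

/-- The continuous pairing is bounded on a product of closed balls. The resulting `D` does not
depend on `f`, which later justifies exchanging sum and integral. -/
theorem exists_norm_topWedge_le (h : q + k = N) (hQ : IsCompact Q) {B : ℝ}
    (hv : Continuous v) (hsupp : Function.support v ⊆ Q) :
    ∃ D : ℝ, ∀ f : DForm N q, (∀ x ∈ Q, ‖f x‖ ≤ B) →
      ∫ x, ‖topWedge h (f x) (v x)‖ ≤ D := by
  obtain ⟨V, hV⟩ := hQ.exists_bound_of_continuousOn hv.continuousOn
  have := FiniteDimensional.proper ℝ ((Eu N) [⋀^Fin q]→L[ℝ] ℂ)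
  have := FiniteDimensional.proper ℝ ((Eu N) [⋀^Fin k]→L[ℝ] ℂ)
  have hcont : Continuous fun p : ((Eu N) [⋀^Fin q]→L[ℝ] ℂ) × ((Eu N) [⋀^Fin k]→L[ℝ] ℂ) =>
      topWedge h p.1 p.2 := ((topWedgeL h).continuous.comp continuous_fst).clm_apply continuous_snd
  obtain ⟨D, hD⟩ := ((isCompact_closedBall (0 : (Eu N) [⋀^Fin q]→L[ℝ] ℂ) B).prod
    (isCompact_closedBall (0 : (Eu N) [⋀^Fin k]→L[ℝ] ℂ) V)).exists_bound_of_continuousOn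
      hcont.continuousOn
  refine ⟨D * MeasureTheory.volume.real Q, fun f hB => ?_⟩
  have h1 : ∫ x, ‖topWedge h (f x) (v x)‖ = ∫ x in Q, ‖topWedge h (f x) (v x)‖ := by
    refine (MeasureTheory.setIntegral_eq_integral_of_forall_compl_eq_zero fun x hx => ?_).symm
    have h0 : v x = 0 := Function.notMem_support.1 fun hxs => hx (hsupp hxs)
    rw [h0, ← topWedgeL_apply, map_zero, norm_zero]
  rw [h1]
  refine (le_abs_self _).trans ?_
  rw [← Real.norm_eq_abs]
  refine MeasureTheory.norm_setIntegral_le_of_norm_le_const hQ.measure_lt_top fun x hx => ?_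
  rw [norm_norm]
  exact hD (f x, v x) ⟨by simpa using hB x hx, by simpa using hV x hx⟩

theorem hasSum_integral_topWedge (h : q + k = N) (hQ : IsCompact Q) (hQΩ : Q ⊆ Ω)
    (hf : ∀ j, ContinuousOn (f j) Ω) {B : ℝ} (hB : ∀ j, ∀ x ∈ Q, ‖f j x‖ ≤ B)
    (hv : Continuous v) (hsupp : Function.support v ⊆ Q) :
    (∃ D : ℝ, ∀ j, ‖∫ x, topWedge h (f j x) (v x)‖ ≤ D) ∧
    ∀ a : ℕ → ℝ, (Summable fun j => |a j|) →
      HasSum (fun j => a j • ∫ x, topWedge h (f j x) (v x))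
        (∫ x, topWedge h (∑' j, (a j • f j) x) (v x)) := by
  obtain ⟨D, hD⟩ := exists_norm_topWedge_le h hQ hv hsupp
  refine ⟨⟨D, fun j => (MeasureTheory.norm_integral_le_integral_norm _).trans (hD _ (hB j))⟩,
    fun a ha => ?_⟩
  have hint : ∀ j, MeasureTheory.Integrable fun x => a j • topWedge h (f j x) (v x) := fun j =>
    (integrable_topWedge h hQ hQΩ (hf j) hv hsupp).smul (a j)
  have hsum : Summable fun j => ∫ x, ‖a j • topWedge h (f j x) (v x)‖ := by
    refine Summable.of_nonneg_of_le (fun j => MeasureTheory.integral_nonneg fun x => norm_nonneg _)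
      (fun j => ?_) (ha.mul_right D)
    simp only [norm_smul, Real.norm_eq_abs]
    rw [MeasureTheory.integral_const_mul]
    exact mul_le_mul_of_nonneg_left (hD _ (hB j)) (abs_nonneg _)
  have h1 := MeasureTheory.hasSum_integral_of_summable_integral_norm hint hsum
  simp only [MeasureTheory.integral_smul] at h1
  suffices h3 : ∀ x, topWedge h (∑' j, (a j • f j) x) (v x) =
      ∑' j, a j • topWedge h (f j x) (v x) by
    simp only [h3]
    exact h1
  intro x
  by_cases hx : x ∈ Q
  · have h2 : HasSum (fun j => (a j • f j) x) (∑' j, (a j • f j) x) := by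
      refine (Summable.of_norm_bounded (ha.mul_right B) fun j => ?_).hasSum
      rw [Pi.smul_apply, norm_smul, Real.norm_eq_abs]
      exact mul_le_mul_of_nonneg_left (hB j x hx) (abs_nonneg _)
    let A : ((Eu N) [⋀^Fin q]→L[ℝ] ℂ) →L[ℝ] ℂ :=
      LinearMap.toContinuousLinearMap ((topWedgeₗ h).flip (v x))
    refine (h2.mapL A).tsum_eq.symm.trans ?_
    refine tsum_congr fun j => ?_
    exact map_smul ((topWedgeₗ h).flip (v x)) (a j) (f j x)
  · have h0 : v x = 0 := Function.notMem_support.1 fun hxs => hx (hsupp hxs)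
    simp only [h0, ← topWedgeL_apply, map_zero, smul_zero, tsum_zero]

end TopWedge

/-! ### The a priori estimate -/

section Estimate

variable {N q k m : ℕ} {s : ℝ} {T : Eu N → Submodule ℂ (Eu N →L[ℝ] ℂ)}

theorem IsOpen.exists_compact_exhaustion {Ω : Set (Eu N)} (hΩ : IsOpen Ω) :
    ∃ K : ℕ → Set (Eu N), (∀ j, K j ⊆ Ω ∧ IsCompact (K j)) ∧ Monotone K ∧
      ∀ Q ⊆ Ω, IsCompact Q → ∃ j, Q ⊆ K j := by
  have := hΩ.locallyCompactSpace
  let E := CompactExhaustion.choice Ω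
  refine ⟨fun j => Subtype.val '' E j, fun j => ⟨Subtype.coe_image_subset _ _,
    (E.isCompact j).image continuous_subtype_val⟩,
    fun i j hij => Set.image_mono (E.subset hij), fun Q hQ hQc => ?_⟩
  obtain ⟨j, hj⟩ := E.exists_superset_of_isCompact
    (Topology.IsInducing.subtypeVal.isCompact_preimage' hQc (by simpa using hQ))
  exact ⟨j, fun x hx => ⟨⟨x, hQ hx⟩, hj hx, rfl⟩⟩

theorem IsTestFormIn.mono {C : ℝ} {K K' : Set (Eu N)} (hK : IsClosed K) (h : K ⊆ K')
    {v : DForm N k} (hv : IsTestFormIn T m s C K v) : IsTestFormIn T m s C K' v := by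
  obtain ⟨h1, h2, h3, h4⟩ := hv
  refine ⟨h1, h2.trans h, h3, ?_⟩
  refine ((formNorm_mono (Set.subset_univ K') v).trans ?_).trans_lt h4
  exact (formNorm_eq_univ_of_support_subset hK h2).ge

/-- `d'` maps `G^s_0(K, C; Λ^{m,r})` to `G^s_0(K, C'; Λ^{m,r+1})` for `C < C'`. -/
theorem IsTestFormIn.extDeriv {C C' : ℝ} (hs : 0 ≤ s) (hC : 0 < C) (hCC' : C < C')
    {K : Set (Eu N)} (hK : IsClosed K) {v : DForm N k} (hv : IsTestFormIn T m s C K v)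
    (hT : ∀ x ∈ K, _root_.extDeriv v x ∈ idealPart (T x) m (k + 1)) :
    IsTestFormIn T m s C' K (_root_.extDeriv v) := by
  have hsupp := support_extDeriv_subset hK hv.2.1
  refine ⟨contDiff_iff_contDiffAt.2 fun x => contDiffAt_extDeriv hv.1.contDiffAt, hsupp,
    fun x => ?_, formNorm_extDeriv_lt_top hs hC hCC' hv.1 hv.2.2.2⟩
  by_cases hx : x ∈ K
  · exact hT x hx
  · rw [Function.notMem_support.1 fun h => hx (hsupp h)]
    exact zero_mem _

/-- The integral is `±u(dv)`, and `dv` is a test form on which `u` is bounded. -/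
theorem norm_integral_le_of_solvesOn (h : q + k = N) {C C' : ℝ} {Ω V K : Set (Eu N)}
    (hK : IsCompact K) (hKV : K ⊆ V) (hVΩ : V ⊆ Ω) (hC : 0 < C) (hC' : 0 < C')
    {u : DForm N (k + 1) → ℂ} (hu : IsUltracurrent T m s V u) {f : DForm N q}
    (hsol : SolvesOn h T m s V u f)
    (hd : ∀ v : DForm N k, IsTestFormIn T m s C K v → IsTestFormIn T m s C' K (extDeriv v)) :
    ∃ B : ℝ, 0 ≤ B ∧ ∀ v : DForm N k, IsTestFormIn T m s C K v →
      ‖∫ x in Ω, topWedge h (f x) (v x)‖ ≤ B * (formNorm s C' K (extDeriv v)).toReal := by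
  obtain ⟨B, hB, hub⟩ := hu.2.2 K hKV hK C' hC'
  refine ⟨B, hB.le, fun v hv => ?_⟩
  have h1 := hsol v ⟨K, hKV, hK, C, hC, hv⟩
  rw [setIntegral_topWedge h hKV f hv.2.1] at h1
  rw [setIntegral_topWedge h (hKV.trans hVΩ) f hv.2.1, ← h1, norm_mul, norm_pow, norm_neg,
    norm_one, one_pow, one_mul]
  have h2 := hub _ (hd v hv)
  rw [formNorm_eq_ofReal_toReal (hd v hv).2.2.2, ← ENNReal.ofReal_mul hB.le,
    ENNReal.ofReal_le_ofReal_iff (by positivity)] at h2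
  exact h2

/-- Local solvability implies the a priori estimate. -/
theorem exists_estimate_of_locallySolvable (h : q + k = N) {y₀ : Eu N} {C₁ C C' : ℝ}
    (hC₁ : 0 < C₁) (hC : 0 < C) (hC' : 0 < C') {Ω : Set (Eu N)} (hΩ : IsOpen Ω) (hy₀ : y₀ ∈ Ω)
    (hsolv : ∀ f : DForm N q, IsGevreyFormSome s Ω f → IsCocycle T Ω f →
        ∃ V : Set (Eu N), IsOpen V ∧ y₀ ∈ V ∧ V ⊆ Ω ∧
          ∃ u : DForm N (k + 1) → ℂ, IsUltracurrent T m s V u ∧ SolvesOn h T m s V u f)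
    (hd : ∀ K ⊆ Ω, IsClosed K → ∀ v : DForm N k, IsTestFormIn T m s C K v →
      IsTestFormIn T m s C' K (extDeriv v)) :
    ∃ K ⊆ Ω, IsCompact K ∧
      ∃ Ω' : Set (Eu N), IsOpen Ω' ∧ y₀ ∈ Ω' ∧ IsCompact (closure Ω') ∧ closure Ω' ⊆ Ω ∧
      ∃ B : ℝ, 0 < B ∧ ∀ f : DForm N q, IsGevreyForm s C₁ Ω f → IsCocycle T Ω f →
        ∀ v : DForm N k, IsTestFormIn T m s C (closure Ω') v →
          ENNReal.ofReal ‖∫ x in Ω, topWedge h (f x) (v x)‖ ≤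
            ENNReal.ofReal B * formNorm s C₁ K f * formNorm s C' (closure Ω') (extDeriv v) := by
  by_contra hcon
  push Not at hcon
  obtain ⟨K, hK, hKmono, hKex⟩ := hΩ.exists_compact_exhaustion
  obtain ⟨ρ, hρ, hρΩ⟩ := Metric.nhds_basis_closedBall.mem_iff.1 (hΩ.mem_nhds hy₀)
  let r : ℕ → ℝ := fun j => ρ / (j + 1)
  have hr : ∀ j, 0 < r j := fun j => by positivity
  have hranti : Antitone r := fun i j hij => by
    have : (i : ℝ) ≤ j := Nat.cast_le.2 hij
    simp only [r]; gcongr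
  have hcl : ∀ j, closure (Metric.ball y₀ (r j)) = Metric.closedBall y₀ (r j) := fun j =>
    closure_ball y₀ (hr j).ne'
  have hr0 : r 0 = ρ := by simp [r]
  have hsubΩ : ∀ j, Metric.closedBall y₀ (r j) ⊆ Ω := fun j =>
    (Metric.closedBall_subset_closedBall ((hranti (Nat.zero_le j)).trans_eq hr0)).trans hρΩ
  let 𝒱 : ℕ → Set (DForm N k) := fun j => {v | IsTestFormIn T m s C (Metric.closedBall y₀ (r j)) v}
  have h𝒱anti : ∀ i j, i ≤ j → 𝒱 j ⊆ 𝒱 i := fun i j hij v hv =>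
    IsTestFormIn.mono Metric.isClosed_closedBall
      (Metric.closedBall_subset_closedBall (hranti hij)) hv
  -- The norm over the whole space equals the norm over any ball containing the support, so `R` is
  -- independent of the radius.
  let R : DForm N k → ℝ := fun v => (formNorm s C' Set.univ (extDeriv v)).toReal
  have hR0 : ∀ v, 0 ≤ R v := fun v => ENNReal.toReal_nonneg
  have hR : ∀ j, ∀ v ∈ 𝒱 j, formNorm s C' (Metric.closedBall y₀ (r j)) (extDeriv v) =
      ENNReal.ofReal (R v) := by
    intro j v hv
    have hdv := hd _ (hsubΩ j) Metric.isClosed_closedBall v hv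
    rw [formNorm_eq_ofReal_toReal hdv.2.2.2,
      formNorm_eq_univ_of_support_subset Metric.isClosed_closedBall hdv.2.1]
  have hbad : ∀ j : ℕ, ∃ f : DForm N q, ContDiffOn ℝ ∞ f Ω ∧
      (∀ Q ⊆ Ω, IsCompact Q → formNorm s C₁ Q f < ⊤) ∧ IsCocycle T Ω f ∧
      formNorm s C₁ (K j) f ≤ ENNReal.ofReal 1 ∧
      ∃ v ∈ 𝒱 j, (j + 1) * R v < ‖∫ x in Ω, topWedge h (f x) (v x)‖ := by
    intro j
    obtain ⟨f, hf, hfc, v, hv, hlt⟩ := hcon (K j) (hK j).1 (hK j).2 (Metric.ball y₀ (r j))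
      Metric.isOpen_ball (Metric.mem_ball_self (hr j)) (hcl j ▸ isCompact_closedBall _ _)
      (hcl j ▸ hsubΩ j) (j + 1) (by positivity)
    rw [hcl] at hv hlt
    rw [hR j v hv, formNorm_eq_ofReal_toReal (hf.2 _ (hK j).1 (hK j).2),
      ← ENNReal.ofReal_mul (by positivity), ← ENNReal.ofReal_mul (by positivity),
      ENNReal.ofReal_lt_ofReal_iff_of_nonneg (by positivity [hR0 v])] at hlt
    set n₀ := (formNorm s C₁ (K j) f).toReal with hn₀
    have hn₀0 : 0 ≤ n₀ := ENNReal.toReal_nonneg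
    have hn₀le := (formNorm_eq_ofReal_toReal (hf.2 _ (hK j).1 (hK j).2)).le
    -- Normalization of `f` on `K j`. If its norm there is zero, any multiple is admissible and a
    -- large one restores the strict inequality, as the integral is nonzero.
    obtain ⟨c, hc0, hc1, hc2⟩ : ∃ c : ℝ, 0 ≤ c ∧ c * n₀ ≤ 1 ∧
        (j + 1) * R v < c * ‖∫ x in Ω, topWedge h (f x) (v x)‖ := by
      rcases hn₀0.eq_or_lt with h0 | h0
      · rw [← h0] at hlt ⊢
        rw [mul_zero, zero_mul] at hlt
        obtain ⟨c, hc⟩ := exists_nat_gt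
          ((j + 1) * R v / ‖∫ x in Ω, topWedge h (f x) (v x)‖)
        exact ⟨c, by positivity, by simp, (div_lt_iff₀ hlt).1 hc⟩
      · refine ⟨n₀⁻¹, by positivity, (inv_mul_cancel₀ h0.ne').le, ?_⟩
        rw [inv_mul_eq_div, lt_div_iff₀ h0]
        linarith
    refine ⟨c • f, hf.1.const_smul c, fun Q hQ hQc => ?_, fun x hx => ?_, ?_, v, hv, ?_⟩
    · exact (formNorm_const_smul_le hC₁ ENNReal.toReal_nonneg hΩ hQ hf.1
        (formNorm_eq_ofReal_toReal (hf.2 Q hQ hQc)).le hc0).trans_lt ENNReal.ofReal_lt_top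
    · rw [extDeriv_smul]
      exact Submodule.smul_of_tower_mem _ c (hfc x hx)
    · exact (formNorm_const_smul_le hC₁ hn₀0 hΩ (hK j).1 hf.1 hn₀le hc0).trans
        (ENNReal.ofReal_le_ofReal hc1)
    · have h1 : ∀ x, topWedge h ((c • f) x) (v x) = c • topWedge h (f x) (v x) := fun x =>
        LinearMap.map_smul₂ (topWedgeₗ h) c (f x) (v x)
      simp only [h1]
      rwa [MeasureTheory.integral_smul, norm_smul, Real.norm_of_nonneg hc0]
  choose f hfs hfn hfc hf1 v hv hvlt using hbad
  have hbound : ∀ Q ⊆ Ω, IsCompact Q →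
      ∃ B : ℝ, 0 ≤ B ∧ ∀ j, formNorm s C₁ Q (f j) ≤ ENNReal.ofReal B := by
    intro Q hQ hQc
    obtain ⟨j₀, hj₀⟩ := hKex Q hQ hQc
    -- For `j ≥ j₀` the set `K j` contains `Q`, so the norm is at most 1. The finitely many earlier
    -- norms are finite and are added.
    refine ⟨1 + ∑ j ∈ Finset.range j₀, (formNorm s C₁ Q (f j)).toReal, by positivity, fun j => ?_⟩
    rcases lt_or_ge j j₀ with hj | hj
    · rw [formNorm_eq_ofReal_toReal (hfn j Q hQ hQc)]
      refine ENNReal.ofReal_le_ofReal ?_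
      have := Finset.single_le_sum (f := fun j => (formNorm s C₁ Q (f j)).toReal)
        (fun _ _ => ENNReal.toReal_nonneg) (Finset.mem_range.2 hj)
      linarith
    · refine ((formNorm_mono (hj₀.trans (hKmono hj)) _).trans (hf1 j)).trans
        (ENNReal.ofReal_le_ofReal ?_)
      exact le_add_of_nonneg_right (Finset.sum_nonneg fun _ _ => ENNReal.toReal_nonneg)
  obtain ⟨B₀, hB₀0, hB₀⟩ := hbound _ hρΩ (isCompact_closedBall _ _)
  have hsup : ∀ j, ∀ x ∈ Metric.closedBall y₀ ρ, ‖f j x‖ ≤ B₀ * derivBound N q s C₁ 0 := by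
    intro j x hx
    rw [← norm_iteratedFDeriv_zero (𝕜 := ℝ)]
    exact norm_iteratedFDeriv_le_of_formNorm_le hC₁ hΩ hρΩ (hfs j) hB₀0 (hB₀ j) 0 hx
  have hseries : ∀ j, ∀ w ∈ 𝒱 j, _ := fun j w hw =>
    have hw0 := h𝒱anti 0 j (Nat.zero_le j) hw
    hasSum_integral_topWedge h (isCompact_closedBall y₀ ρ) hρΩ (fun i => (hfs i).continuousOn)
      hsup hw0.1.continuous (hr0 ▸ hw0.2.1)
  have hset : ∀ (g : DForm N q), ∀ j, ∀ w ∈ 𝒱 j, ∫ x in Ω, topWedge h (g x) (w x) =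
      ∫ x, topWedge h (g x) (w x) := fun g j w hw => setIntegral_topWedge h (hsubΩ j) g hw.2.1
  obtain ⟨j, B, hjB⟩ := exists_uniform_bound_of_pointwise_bound 𝒱 R
    (fun w i => ∫ x, topWedge h (f i x) (w x)) (fun j w hw => (hseries j w hw).1) fun a => by
      have ha := summable_abs_of_lp_one a
      obtain ⟨V, hV, hy₀V, hVΩ, u, hu, hsol⟩ := hsolv _
        (isGevreyFormSome_tsum hC₁ hΩ hfs hbound ha) (isCocycle_tsum hC₁ hΩ hfs hbound ha hfc)
      obtain ⟨δ, hδ, hδV⟩ := Metric.nhds_basis_closedBall.mem_iff.1 (hV.mem_nhds hy₀V)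
      obtain ⟨j₁, hj₁⟩ := exists_nat_gt (ρ / δ)
      have hrδ : r j₁ ≤ δ := by
        simp only [r]
        rw [div_le_iff₀ (by positivity)]
        rw [div_lt_iff₀ hδ] at hj₁
        nlinarith
      obtain ⟨B, hB0, hB⟩ := norm_integral_le_of_solvesOn h (isCompact_closedBall y₀ (r j₁))
        ((Metric.closedBall_subset_closedBall hrδ).trans hδV) hVΩ hC hC' hu hsol
        (hd _ (hsubΩ j₁) Metric.isClosed_closedBall)
      obtain ⟨j₂, hj₂⟩ := exists_nat_ge B
      -- `j₁` makes the ball fit into the domain `V` of the solution, and `j₂` dominates the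
      -- continuity constant of `u`. A single index must serve for both.
      refine ⟨max j₁ j₂, fun w hw => ?_⟩
      have hw₁ := h𝒱anti j₁ _ (le_max_left j₁ j₂) hw
      rw [((hseries _ w hw).2 a ha).tsum_eq, ← hset _ _ w hw]
      refine (hB w hw₁).trans ?_
      rw [hR j₁ w hw₁, ENNReal.toReal_ofReal (hR0 w)]
      refine mul_le_mul_of_nonneg_right (hj₂.trans ?_) (hR0 w)
      exact Nat.cast_le.2 (le_max_right j₁ j₂)
  obtain ⟨i, hi⟩ := exists_nat_ge B
  -- At `p` the form `v p` belongs to the family `𝒱 j`, and `B ≤ p + 1`, so the uniform bound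
  -- contradicts the choice of `f p` and `v p`.
  let p := max i j
  have h1 := hjB (v p) (h𝒱anti j p (le_max_right i j) (hv p)) p
  have h2 := hvlt p
  rw [hset _ _ _ (hv p)] at h2
  have h3 : B ≤ p + 1 := by
    have : (i : ℝ) ≤ p := Nat.cast_le.2 (le_max_left i j)
    linarith
  exact absurd (h1.trans (mul_le_mul_of_nonneg_right h3 (hR0 _))) (not_le.2 h2)

end Estimate

end

theorem mainTheorem2 {m n : ℕ} {M : Type*} [TopologicalSpace M] [ChartedSpace (Eu (m + n)) M]
    [IsManifold 𝓘(ℝ, Eu (m + n)) ω M] (S : LocallyIntegrableStructure m n M) (x₀ : M)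
    (φ : OpenPartialHomeomorph M (Eu (m + n)))
    (hφ : φ ∈ IsManifold.maximalAtlas 𝓘(ℝ, Eu (m + n)) ω M) (hx₀ : x₀ ∈ φ.source)
    {q : ℕ} (hq1 : 1 ≤ q) (hqn : q ≤ n) {s : ℝ} (hs : 1 < s)
    (hsolv : LocallySolvable (q := q) (k := m + (n - q)) (by omega) (S.inChart φ) m s
      φ.target (φ x₀)) :
    ∃ U : Set (Eu (m + n)), IsOpen U ∧ φ x₀ ∈ U ∧ U ⊆ φ.target ∧
      ∀ Ω : Set (Eu (m + n)), IsOpen Ω → φ x₀ ∈ Ω → Ω ⊆ U →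
      ∀ C₁ : ℝ, 0 < C₁ → ∀ C₂ ε : ℝ, 0 < ε → ε < C₂ →
      ∃ K ⊆ Ω, IsCompact K ∧
      ∃ Ω' : Set (Eu (m + n)), IsOpen Ω' ∧ φ x₀ ∈ Ω' ∧ IsCompact (closure Ω') ∧ closure Ω' ⊆ Ω ∧
      ∃ C' : ℝ, 0 < C' ∧
        ∀ f : DForm (m + n) q, IsGevreyForm s C₁ Ω f → IsCocycle (S.inChart φ) Ω f →
        ∀ v : DForm (m + n) (m + (n - q)),
          IsTestFormIn (S.inChart φ) m s (C₂ - ε) (closure Ω') v →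
          formNorm s C₂ (closure Ω') (extDeriv v) < ⊤ ∧
          ENNReal.ofReal ‖∫ x in Ω, topWedge (by omega) (f x) (v x)‖ ≤
            ENNReal.ofReal C' * formNorm s C₁ K f *
              formNorm s C₂ (closure Ω') (extDeriv v) := by

  obtain ⟨U, hU, hyU, hUφ, hsol⟩ := hsolv
  refine ⟨U, hU, hyU, hUφ, fun Ω hΩ hyΩ hΩU C₁ hC₁ C₂ ε hε hεC₂ => ?_⟩
  -- The gap `ε` is the room for the lost derivative. Since `T'` is described by the chart only on
  -- `φ.target`, the ideal condition on `dv` is checked on `K ⊆ Ω ⊆ U`; off `K` the form `dv`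
  -- vanishes.
  have hd : ∀ K ⊆ Ω, IsClosed K → ∀ v : DForm (m + n) (m + (n - q)),
      IsTestFormIn (S.inChart φ) m s (C₂ - ε) K v →
      IsTestFormIn (S.inChart φ) m s C₂ K (extDeriv v) := fun K hKΩ hK v hv =>
    hv.extDeriv (by linarith) (by linarith) (by linarith) hK fun x hx =>
      S.extDeriv_mem_idealPart hφ hv.1 hv.2.2.1 (hUφ (hΩU (hKΩ hx)))
  obtain ⟨K, hKΩ, hK, Ω', hΩ', hyΩ', hc, hcΩ, B, hB, hest⟩ :=
    exists_estimate_of_locallySolvable _ hC₁ (C := C₂ - ε) (C' := C₂) (by linarith)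
      (by linarith) hΩ hyΩ (hsol Ω hΩ hyΩ hΩU) hd
  exact ⟨K, hKΩ, hK, Ω', hΩ', hyΩ', hc, hcΩ, B, hB, fun f hf hfc v hv =>
    ⟨(hd _ hcΩ isClosed_closure v hv).2.2.2, hest f hf hfc v hv⟩⟩
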